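/- **Setting.** Let $G$ be a semisimple algebraic group of adjoint type over $\mathbb{C}$, with a Borel subgroup $B^+$, a maximal torus $H\subset B^+$, simple roots $\alpha_s$ with homomorphisms $\varphi_s:\mathrm{SL}_2\to G$, and the corresponding transpose anti-involution $g\mapsto g^{\mathsf T}$ with $B^-=(B^+)^{\mathsf T}$. Let $\overline{w}_0=\overline{r}_{s_1}\cdots\overline{r}_{s_N}$, with $\overline{r}_s=\varphi_s\begin{pmatrix}0&-1\\1&0\end{pmatrix}$ and $s_1\cdots s_N$ a reduced word of the longest element $w_0$ of the Weyl group, be its standard lift to $N_G(H)$. The flag variety is $\mathcal{B}_G=G/B^+$. The space of pinnings $\mathcal{P}_G$ is a principal homogeneous $G$-space with base point $p_{\mathrm{std}}$; it has projections $\pi_\pm:\mathcal{P}_G\to\mathcal{B}_G$ with $\pi_+(g.p_{\mathrm{std}})=gB^+$ and $\pi_-(g.p_{\mathrm{std}})=g\overline{w}_0B^+$, and the opposite of the pinning $g.p_{\mathrm{std}}$ is $(g.p_{\mathrm{std}})^*=g\overline{w}_0.p_{\mathrm{std}}$. A marked surface $\Sigma$ is a compact oriented surface with boundary, possibly disconnected,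 with a finite non-empty set $\mathbb{M}$ of marked points such that each boundary component contains a marked point. The boundary intervals are the components of $\partial\Sigma\setminus\mathbb{M}$, oriented as parts of $\partial\Sigma$. A framed $G$-local system with pinnings on $\Sigma$ is a triple $(\mathcal{L},\beta;p)$, where $\mathcal{L}$ is a $G$-local system on $\Sigma\setminus\mathbb{M}$, $\beta$ is a flat section of $\mathcal{L}\times_G\mathcal{B}_G$ near $\mathbb{M}$, and $p=(p_E)_E$ is a flat section of $\mathcal{L}\times_G\mathcal{P}_G$ over the boundary intervals $E$, such that $\pi_+(p_E)$ and $\pi_-(p_E)$ are the flags given by $\beta$ at the initial and the terminal point of $E$. Let $\mathcal{P}_{G,\Sigma}$ be the moduli stack over $\mathbb{C}$ of framed $G$-local systems with pinnings on $\Sigma$. * An *arc class* $[c]:E_1\to E_2$ is a homotopy class of paths in $\Sigma\setminus\mathbb{M}$ from a point of $E_1$ to a point of $E_2$, with end points moving in $E_1$ and $E_2$. The *Wilson line* $g_{[c]}:\mathcal{P}_{G,\Sigma}\to G$ is the morphism defined as follows: choose the local trivialization of $\mathcal{L}$ near $E_1$ under which $p_{E_1}$ corresponds to $p_{\mathrm{std}}$,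 and continue it along $c$; if $p_{E_2}$ corresponds to $h.p_{\mathrm{std}}$, then $g_{[c]}(\mathcal{L},\beta;p)=h\overline{w}_0$, that is, $p_{E_2}$ corresponds to $g_{[c]}(\mathcal{L},\beta;p).p_{\mathrm{std}}^*$. * The *Wilson loop* $\rho_{|\gamma|}:\mathcal{P}_{G,\Sigma}\to[G/\mathrm{Ad}\,G]$ along a free loop $|\gamma|$ in $\Sigma\setminus\mathbb{M}$ is the morphism of stacks sending $(\mathcal{L},\beta;p)$ to the fibre of $\mathcal{L}$ at the base point of a loop $\gamma$ representing $|\gamma|$, a principal $G$-bundle, together with the equivariant map to $G$ given by the matrix of the monodromy of $\mathcal{L}$ along $\gamma$ with respect to a frame. Here the monodromy along $\gamma$ transports a vector at the end of $\gamma$ back to its beginning. Let $E_1\neq E_2$ be boundary intervals of a marked surface $\Sigma$, and let $\Sigma'$ be the marked surface obtained from $\Sigma$ by gluing $E_1$ to $E_2$ by an orientation-reversing identification. The *gluing morphism* $q_{E_1,E_2}:\mathcal{P}_{G,\Sigma}\to\mathcal{P}_{G,\Sigma'}$ sends $(\mathcal{L},\beta;p)$ to the framed $G$-local system with pinnings on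 $\Sigma'$ obtained by gluing $\mathcal{L}$ along $E_1$ and $E_2$ by the unique isomorphism which identifies $p_{E_1}$ with $p_{E_2}^*$. An arc class $[c]:E_1\to E_2$ gives rise to a free loop $|\gamma|$ on $\Sigma'$: represent $[c]$ by a path whose end points are identified in $\Sigma'$ and take the free homotopy class of its image. **Proposition 3.6.** Let $\Sigma$ be a marked surface and $[c]:E_1\to E_2$ an arc class between two distinct boundary intervals of $\Sigma$. Let $\Sigma'$ be the marked surface obtained from $\Sigma$ by gluing $E_1$ and $E_2$, and let $|\gamma|$ be the free loop on $\Sigma'$ arising from $[c]$. Then the diagram of morphisms of stacks $$\begin{array}{ccc}\mathcal{P}_{G,\Sigma}&\xrightarrow{\;g_{[c]}\;}&G\\ {\scriptstyle q_{E_1,E_2}}\downarrow&&\downarrow\\ \mathcal{P}_{G,\Sigma'}&\xrightarrow{\;\rho_{|\gamma|}\;}&[G/\mathrm{Ad}\,G]\end{array}$$ in which the right vertical morphism is the canonical projection, commutes: the two composites $\mathcal{P}_{G,\Sigma}\to[G/\mathrm{Ad}\,G]$ are isomorphic as morphisms of stacks (2-isomorphic). -/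

import Mathlib

open CategoryTheory AlgebraicGeometry MonoidalCategory CartesianMonoidalCategory Topology Filter
open scoped unitInterval ContDiff

attribute [local instance] CategoryTheory.Hom.group

noncomputable section

namespace WilsonLines

/-! ### Algebraic groups over `ℂ` through their functors of points -/

/-- The category of schemes over `ℂ`. -/
abbrev SchC := Over (Spec (CommRingCat.of ℂ))

/-- The ring `𝒪(S)` of global functions of a scheme, i.e. the `S`-points of the affine line. -/
abbrev Fun (S : SchC) : Type := Γ(S.left, ⊤)

/-- Pull-back of functions along a morphism of schemes. -/
abbrev pullFun {S S' : SchC} (u : S' ⟶ S) : Fun S →+* Fun S' := u.left.appTop.hom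

/-- Coverings in the (big) étale topology: a single étale surjective morphism. -/
def IsEtaleCover {U T : SchC} (u : U ⟶ T) : Prop :=
  Etale u.left ∧ AlgebraicGeometry.Surjective u.left

/-- A closed subgroup scheme of a group scheme `G` over `ℂ`. -/
structure ClosedSubgroup (G : SchC) [GrpObj G] where
  carrier : SchC
  incl : carrier ⟶ G
  closed : IsClosedImmersion incl.left
  one_mem : ∀ S : SchC, ∃ y : S ⟶ carrier, y ≫ incl = 1
  mul_mem : ∀ (S : SchC) (y z : S ⟶ carrier), ∃ x : S ⟶ carrier, x ≫ incl = (y ≫ incl) * (z ≫ incl)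
  inv_mem : ∀ (S : SchC) (y : S ⟶ carrier), ∃ x : S ⟶ carrier, x ≫ incl = (y ≫ incl)⁻¹

/-- The group of `S`-points of a closed subgroup scheme, as a subgroup of `G(S)`. -/
def ClosedSubgroup.pts {G : SchC} [GrpObj G] (N : ClosedSubgroup G) (S : SchC) :
    Subgroup (S ⟶ G) where
  carrier := {x | ∃ y : S ⟶ N.carrier, y ≫ N.incl = x}
  one_mem' := N.one_mem S
  mul_mem' := by
    rintro _ _ ⟨y, rfl⟩ ⟨z, rfl⟩
    exact N.mul_mem S y z
  inv_mem' := by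
    rintro _ ⟨y, rfl⟩
    exact N.inv_mem S y

lemma ClosedSubgroup.comp_mem {G : SchC} [GrpObj G] (N : ClosedSubgroup G) {S S' : SchC}
    (u : S' ⟶ S) {x : S ⟶ G} (hx : x ∈ N.pts S) : u ≫ x ∈ N.pts S' := by
  obtain ⟨y, rfl⟩ := hx
  exact ⟨u ≫ y, by simp⟩

/-- Upper triangular unipotent matrix. -/
def upper {R : Type} [CommRing R] (t : R) : Matrix.SpecialLinearGroup (Fin 2) R :=
  ⟨!![1, t; 0, 1], by simp [Matrix.det_fin_two]⟩

/-- Lower triangular unipotent matrix. -/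
def lower {R : Type} [CommRing R] (t : R) : Matrix.SpecialLinearGroup (Fin 2) R :=
  ⟨!![1, 0; t, 1], by simp [Matrix.det_fin_two]⟩

/-- The diagonal matrix with entries `a`, `a⁻¹`. -/
def diag {R : Type} [CommRing R] (a : Rˣ) : Matrix.SpecialLinearGroup (Fin 2) R :=
  ⟨!![(a : R), 0; 0, ((a⁻¹ : Rˣ) : R)], by simp [Matrix.det_fin_two]⟩

/-- The matrix with rows `(0, -1)` and `(1, 0)`. -/
def weyl {R : Type} [CommRing R] : Matrix.SpecialLinearGroup (Fin 2) R :=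
  ⟨!![0, -1; 1, 0], by simp [Matrix.det_fin_two]⟩

lemma weyl_eq {R : Type} [CommRing R] :
    (weyl : Matrix.SpecialLinearGroup (Fin 2) R) = upper (-1) * lower 1 * upper (-1) := by
  apply Subtype.ext
  rw [Matrix.SpecialLinearGroup.coe_mul, Matrix.SpecialLinearGroup.coe_mul]
  simp [weyl, upper, lower]

lemma weyl_inv_eq {R : Type} [CommRing R] :
    lower (-1) * upper 1 * lower (-1) * (weyl : Matrix.SpecialLinearGroup (Fin 2) R) = 1 := by
  apply Subtype.ext
  rw [Matrix.SpecialLinearGroup.coe_mul, Matrix.SpecialLinearGroup.coe_mul,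
    Matrix.SpecialLinearGroup.coe_mul]
  simp [weyl, upper, lower, Matrix.one_fin_two]

/-- A semisimple algebraic group `G` of adjoint type over `ℂ`, together with the standard
Lie theoretic data: a Borel subgroup `B⁺ = B`, a maximal torus `H ⊆ B⁺`, the simple roots `α s`, the
homomorphisms `φ s : SL₂ → G` of the simple roots, the transpose `T`, and a reduced word `word` of
the longest element `w₀` of the Weyl group. -/
structure AdjointGroup where
  G : SchC
  [grp : GrpObj G]
  affine : IsAffine G.left
  finiteType : LocallyOfFiniteType G.hom
  /-- `G` is reduced and connected -/
  integral : IsIntegral G.left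
  /-- `G` is semisimple: its radical is trivial -/
  semisimple : ∀ N : ClosedSubgroup G, IsIntegral N.carrier.left → (∀ S, (N.pts S).Normal) →
    Group.IsSolvable (N.pts (𝟙_ SchC)) → ∀ S, N.pts S = ⊥
  /-- `G` has trivial scheme-theoretic centre -/
  center_trivial : ∀ (S : SchC) (g : S ⟶ G),
    (∀ (S' : SchC) (u : S' ⟶ S) (x : S' ⟶ G), (u ≫ g) * x = x * (u ≫ g)) → g = 1
  /-- the Borel subgroup `B⁺` -/
  B : ClosedSubgroup G
  B_integral : IsIntegral B.carrier.left
  B_solvable : Group.IsSolvable (B.pts (𝟙_ SchC))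
  B_maximal : ∀ B' : ClosedSubgroup G, IsIntegral B'.carrier.left →
    Group.IsSolvable (B'.pts (𝟙_ SchC)) → (∀ S, B.pts S ≤ B'.pts S) → ∀ S, B'.pts S ≤ B.pts S
  /-- the maximal torus -/
  H : ClosedSubgroup G
  H_le_B : ∀ S, H.pts S ≤ B.pts S
  /-- the index set of the simple roots -/
  ι : Type
  [finite_ι : Finite ι]
  /-- the simple roots `α s : H → 𝔾ₘ` -/
  α : ι → ∀ S : SchC, H.pts S →* (Fun S)ˣ
  α_natural : ∀ (s : ι) (S S' : SchC) (u : S' ⟶ S) (h : H.pts S),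
    α s S' ⟨u ≫ h.1, H.comp_mem u h.2⟩ = Units.map (pullFun u : Fun S →* Fun S') (α s S h)
  /-- the simple roots form a basis of the character lattice: they identify `H` with `𝔾ₘ ^ ι` -/
  α_bijective : ∀ S : SchC, Function.Bijective fun (h : H.pts S) (s : ι) => α s S h
  /-- the homomorphism `SL₂ → G` of the simple root `α s` -/
  φ : ι → ∀ S : SchC, Matrix.SpecialLinearGroup (Fin 2) (Fun S) →* (S ⟶ G)
  φ_natural : ∀ (s : ι) (S S' : SchC) (u : S' ⟶ S) (A : Matrix.SpecialLinearGroup (Fin 2) (Fun S)),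
    φ s S' (Matrix.SpecialLinearGroup.map (pullFun u) A) = u ≫ φ s S A
  φ_upper_injective : ∀ (s : ι) (S : SchC) (t t' : Fun S),
    φ s S (upper t) = φ s S (upper t') → t = t'
  φ_upper : ∀ (s : ι) (S : SchC) (h : H.pts S) (t : Fun S),
    h.1 * φ s S (upper t) * h.1⁻¹ = φ s S (upper ((α s S h : Fun S) * t))
  φ_lower : ∀ (s : ι) (S : SchC) (h : H.pts S) (t : Fun S),
    h.1 * φ s S (lower t) * h.1⁻¹ = φ s S (lower (((α s S h)⁻¹ : (Fun S)ˣ) * t))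
  /-- the simple coroots take values in `H` -/
  φ_diag : ∀ (s : ι) (S : SchC) (a : (Fun S)ˣ), φ s S (diag a) ∈ H.pts S
  φ_upper_mem : ∀ (s : ι) (S : SchC) (t : Fun S), φ s S (upper t) ∈ B.pts S
  /-- `B⁺` is generated by `H` and the simple root subgroups -/
  B_generated : ∀ C : ClosedSubgroup G, (∀ S, H.pts S ≤ C.pts S) →
    (∀ (s : ι) (S : SchC) (t : Fun S), φ s S (upper t) ∈ C.pts S) → ∀ S, B.pts S ≤ C.pts S
  /-- the transpose -/
  T : G ⟶ G
  T_mul : ∀ (S : SchC) (x y : S ⟶ G), (x * y) ≫ T = (y ≫ T) * (x ≫ T)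
  T_T : T ≫ T = 𝟙 G
  T_H : ∀ (S : SchC) (h : S ⟶ G), h ∈ H.pts S → h ≫ T = h
  T_upper : ∀ (s : ι) (S : SchC) (t : Fun S), φ s S (upper t) ≫ T = φ s S (lower t)
  /-- a word in the simple reflections -/
  word : List ι
  /-- the word represents the element of the Weyl group exchanging `B⁺` and `B⁻ = (B⁺)ᵀ`, that is,
  the longest element `w₀` -/
  word_longest : ∀ (S : SchC) (g : S ⟶ G), g ∈ B.pts S ↔
    ((toUnit S ≫ (word.map fun s => φ s (𝟙_ SchC) weyl).prod) * g *
      (toUnit S ≫ (word.map fun s => φ s (𝟙_ SchC) weyl).prod)⁻¹) ≫ T ∈ B.pts S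
  /-- the word is reduced -/
  word_reduced : ∀ v : List ι,
    (∀ (S : SchC) (g : S ⟶ G), g ∈ B.pts S ↔
      ((toUnit S ≫ (v.map fun s => φ s (𝟙_ SchC) weyl).prod) * g *
        (toUnit S ≫ (v.map fun s => φ s (𝟙_ SchC) weyl).prod)⁻¹) ≫ T ∈ B.pts S) →
    word.length ≤ v.length

attribute [instance] AdjointGroup.grp AdjointGroup.finite_ι

namespace AdjointGroup

variable (A : AdjointGroup)

/-- The lift of the `s`-th simple reflection to `N_G(H)`. -/
def rbar (s : A.ι) : 𝟙_ SchC ⟶ A.G := A.φ s (𝟙_ SchC) weyl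

/-- The lift of the longest element `w₀` to `N_G(H)`, as a `ℂ`-point of `G`. -/
def w0 : 𝟙_ SchC ⟶ A.G := (A.word.map A.rbar).prod

/-- The lift of `w₀` as an `S`-point of `G`. -/
def w0At (S : SchC) : S ⟶ A.G := toUnit S ≫ A.w0

lemma comp_w0At {S S' : SchC} (u : S' ⟶ S) : u ≫ A.w0At S = A.w0At S' := by
  simp [w0At]

lemma one_T (S : SchC) : (1 : S ⟶ A.G) ≫ A.T = 1 := by
  have h := A.T_mul S 1 1
  rw [mul_one] at h
  exact (mul_eq_left.mp h.symm)

lemma inv_T (S : SchC) (x : S ⟶ A.G) : x⁻¹ ≫ A.T = (x ≫ A.T)⁻¹ := by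
  rw [eq_inv_iff_mul_eq_one, ← A.T_mul, mul_inv_cancel, A.one_T]

lemma T_lower (s : A.ι) (S : SchC) (t : Fun S) :
    A.φ s S (lower t) ≫ A.T = A.φ s S (upper t) := by
  rw [← A.T_upper, Category.assoc, A.T_T, Category.comp_id]

lemma rbar_T (s : A.ι) : A.rbar s ≫ A.T = (A.rbar s)⁻¹ := by
  rw [eq_inv_iff_mul_eq_one]
  unfold rbar
  conv_lhs => enter [1]; rw [weyl_eq]
  rw [map_mul, map_mul, A.T_mul, A.T_mul, A.T_upper, A.T_lower, ← map_mul, ← map_mul, ← map_mul,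
    ← mul_assoc, weyl_inv_eq, map_one]

lemma prod_T (l : List A.ι) : (l.map A.rbar).prod ≫ A.T = ((l.map A.rbar).prod)⁻¹ := by
  induction l with
  | nil => simp [A.one_T]
  | cons s l ih => simp only [List.map_cons, List.prod_cons, A.T_mul, ih, A.rbar_T, mul_inv_rev]

lemma w0At_T (S : SchC) : A.w0At S ≫ A.T = (A.w0At S)⁻¹ := by
  rw [w0At, Category.assoc, w0, A.prod_T, GrpObj.comp_inv]

lemma mem_B_iff (S : SchC) (g : S ⟶ A.G) :
    g ∈ A.B.pts S ↔ (A.w0At S * g * (A.w0At S)⁻¹) ≫ A.T ∈ A.B.pts S := A.word_longest S g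

/-- The `S`-points of the normalizer of `B⁺`. It is known to be equal to `B⁺`. -/
def N (S : SchC) : Subgroup (S ⟶ A.G) where
  carrier := {g | ∀ (S' : SchC) (u : S' ⟶ S) (b : S' ⟶ A.G),
    b ∈ A.B.pts S' ↔ (u ≫ g) * b * (u ≫ g)⁻¹ ∈ A.B.pts S'}
  one_mem' := by intro S' u b; simp [MonObj.comp_one]
  mul_mem' := by
    intro g h hg hh S' u b
    rw [hh S' u b, hg S' u, MonObj.comp_mul]
    simp [mul_assoc]
  inv_mem' := by
    intro g hg S' u b
    rw [hg S' u ((u ≫ g⁻¹) * b * (u ≫ g⁻¹)⁻¹), GrpObj.comp_inv]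
    simp [mul_assoc]

lemma N_comp {S S' : SchC} (u : S' ⟶ S) {g : S ⟶ A.G} (hg : g ∈ A.N S) : u ≫ g ∈ A.N S' := by
  intro S'' v b
  rw [← Category.assoc]
  exact hg S'' (v ≫ u) b

lemma w0_sq_mem (S : SchC) : A.w0At S * A.w0At S ∈ A.N S := by
  intro S' u b
  rw [MonObj.comp_mul, A.comp_w0At, A.mem_B_iff S' b,
    A.mem_B_iff S' ((A.w0At S' * b * (A.w0At S')⁻¹) ≫ A.T)]
  simp only [A.T_mul, A.inv_T, A.w0At_T, Category.assoc, A.T_T, Category.comp_id, inv_inv,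
    mul_inv_rev, mul_assoc]

end AdjointGroup

/-! ### Principal bundles and flags -/

/-- A principal `G`-bundle over a scheme `T` (locally trivial in the étale topology): the fibres of
`total → T` are acted upon simply transitively from the right, and there are étale-local
sections. -/
structure Bundle (G : SchC) [GrpObj G] (T : SchC) where
  total : SchC
  proj : total ⟶ T
  act : ∀ {S : SchC}, (S ⟶ total) → (S ⟶ G) → (S ⟶ total)
  comp_act : ∀ {S S' : SchC} (u : S' ⟶ S) (x : S ⟶ total) (g : S ⟶ G),
    u ≫ act x g = act (u ≫ x) (u ≫ g)
  act_one : ∀ {S : SchC} (x : S ⟶ total), act x 1 = x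
  act_mul : ∀ {S : SchC} (x : S ⟶ total) (g h : S ⟶ G), act x (g * h) = act (act x g) h
  act_proj : ∀ {S : SchC} (x : S ⟶ total) (g : S ⟶ G), act x g ≫ proj = x ≫ proj
  simply_transitive : ∀ {S : SchC} (x y : S ⟶ total), x ≫ proj = y ≫ proj → ∃! g, act x g = y
  locally_trivial : ∃ (U : SchC) (u : U ⟶ T) (s : U ⟶ total), IsEtaleCover u ∧ s ≫ proj = u

namespace Bundle

variable {G : SchC} [GrpObj G] {T T' T'' : SchC}

/-- The element `g` with `y = x g`, for two points `x`, `y` of the same fibre. -/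
def div (E : Bundle G T) {S : SchC} (x y : S ⟶ E.total) (h : x ≫ E.proj = y ≫ E.proj) : S ⟶ G :=
  (E.simply_transitive x y h).choose

lemma act_div (E : Bundle G T) {S : SchC} (x y : S ⟶ E.total) (h : x ≫ E.proj = y ≫ E.proj) :
    E.act x (E.div x y h) = y := (E.simply_transitive x y h).choose_spec.1

lemma div_unique (E : Bundle G T) {S : SchC} (x y : S ⟶ E.total) (h : x ≫ E.proj = y ≫ E.proj)
    (g : S ⟶ G) (hg : E.act x g = y) : E.div x y h = g :=
  ((E.simply_transitive x y h).choose_spec.2 g hg).symm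

lemma act_cancel (E : Bundle G T) {S : SchC} {x : S ⟶ E.total} {g h : S ⟶ G}
    (e : E.act x g = E.act x h) : g = h :=
  (E.simply_transitive x (E.act x h) (E.act_proj x h).symm).unique e rfl

/-- `f : E → E'` is a `G`-equivariant map covering `b : T → T'`. Since `E`, `E'` are principal
bundles, the resulting square is automatically Cartesian. -/
structure IsMap (b : T ⟶ T') (E : Bundle G T) (E' : Bundle G T') (f : E.total ⟶ E'.total) :
    Prop where
  proj : f ≫ E'.proj = E.proj ≫ b
  act : ∀ {S : SchC} (x : S ⟶ E.total) (g : S ⟶ G), E.act x g ≫ f = E'.act (x ≫ f) g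

lemma IsMap.id (E : Bundle G T) : IsMap (𝟙 T) E E (𝟙 E.total) := ⟨by simp, by simp⟩

lemma IsMap.comp {b : T ⟶ T'} {b' : T' ⟶ T''} {E : Bundle G T} {E' : Bundle G T'}
    {E'' : Bundle G T''} {f : E.total ⟶ E'.total} {f' : E'.total ⟶ E''.total}
    (h : IsMap b E E' f) (h' : IsMap b' E' E'' f') : IsMap (b ≫ b') E E'' (f ≫ f') :=
  ⟨by rw [Category.assoc, h'.proj, ← Category.assoc, h.proj, Category.assoc],
   fun x g => by rw [← Category.assoc, h.act, h'.act, Category.assoc]⟩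

/-- Isomorphisms of principal bundles over a fixed base are the isomorphisms of this category. -/
instance : Category (Bundle G T) where
  Hom E E' := {f : E.total ⟶ E'.total // IsMap (𝟙 T) E E' f}
  id E := ⟨𝟙 _, IsMap.id E⟩
  comp f g := ⟨f.1 ≫ g.1, by simpa using f.2.comp g.2⟩

@[simp] lemma id_val (E : Bundle G T) : (𝟙 E : E ⟶ E).1 = 𝟙 E.total := rfl

@[simp] lemma comp_val {E E' E'' : Bundle G T} (f : E ⟶ E') (g : E' ⟶ E'') :
    (f ≫ g).1 = f.1 ≫ g.1 := rfl

lemma hom_proj {E E' : Bundle G T} (f : E ⟶ E') : f.1 ≫ E'.proj = E.proj := by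
  simpa using f.2.proj

/-- Global sections of a principal bundle. -/
abbrev Section (E : Bundle G T) : Type := {e : T ⟶ E.total // e ≫ E.proj = 𝟙 T}

/-- Translate of a section by a `T`-point of `G`. -/
def Section.act {E : Bundle G T} (e : E.Section) (g : T ⟶ G) : E.Section :=
  ⟨E.act e.1 g, by rw [E.act_proj, e.2]⟩

/-- Image of a section under a map of bundles. -/
def Section.map {E E' : Bundle G T} (e : E.Section) (f : E ⟶ E') : E'.Section :=
  ⟨e.1 ≫ f.1, by rw [Category.assoc, hom_proj, e.2]⟩

lemma isMap_ext {b : T ⟶ T'} {E : Bundle G T} {E' : Bundle G T'} {f f' : E.total ⟶ E'.total}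
    (h : IsMap b E E' f) (h' : IsMap b E E' f') (e : E.Section) (he : e.1 ≫ f = e.1 ≫ f') :
    f = f' := by
  have hp : (E.proj ≫ e.1) ≫ E.proj = 𝟙 E.total ≫ E.proj := by
    rw [Category.assoc, e.2, Category.comp_id, Category.id_comp]
  have h1 := E.act_div _ _ hp
  rw [← Category.id_comp f, ← Category.id_comp f', ← h1, h.act, h'.act, Category.assoc, he,
    Category.assoc]

/-- The unique isomorphism of bundles carrying a given section to a given section. -/
def frameHom {E E' : Bundle G T} (e : E.Section) (e' : E'.Section) : E ⟶ E' :=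
  have hp : (E.proj ≫ e.1) ≫ E.proj = 𝟙 E.total ≫ E.proj := by
    rw [Category.assoc, e.2, Category.comp_id, Category.id_comp]
  ⟨E'.act (E.proj ≫ e'.1) (E.div (E.proj ≫ e.1) (𝟙 _) hp), by
    constructor
    · rw [E'.act_proj, Category.assoc, e'.2]
    · intro S x g
      have h1 := congrArg (fun z => E.act x g ≫ z) (E.act_div _ _ hp)
      have h2 := congrArg (fun z => x ≫ z) (E.act_div _ _ hp)
      simp only [E.comp_act, Category.comp_id] at h1 h2
      have h3 : E.act x g ≫ E.proj ≫ e.1 = x ≫ E.proj ≫ e.1 := by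
        rw [← Category.assoc, E.act_proj, Category.assoc]
      have h4 : E.act x g ≫ E.proj ≫ e'.1 = x ≫ E.proj ≫ e'.1 := by
        rw [← Category.assoc, E.act_proj, Category.assoc]
      have key : E.act x g ≫ E.div (E.proj ≫ e.1) (𝟙 _) hp =
          (x ≫ E.div (E.proj ≫ e.1) (𝟙 _) hp) * g := by
        apply E.act_cancel (x := x ≫ E.proj ≫ e.1)
        rw [E.act_mul, h2, ← h3, h1]
      rw [E'.comp_act, E'.comp_act, key, E'.act_mul, h4]⟩

lemma comp_frameHom {E E' : Bundle G T} (e : E.Section) (e' : E'.Section) :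
    e.1 ≫ (frameHom e e').1 = e'.1 := by
  have hp : (E.proj ≫ e.1) ≫ E.proj = 𝟙 E.total ≫ E.proj := by
    rw [Category.assoc, e.2, Category.comp_id, Category.id_comp]
  change e.1 ≫ E'.act (E.proj ≫ e'.1) (E.div (E.proj ≫ e.1) (𝟙 _) hp) = _
  rw [E'.comp_act, ← Category.assoc, e.2, Category.id_comp]
  have h1 := congrArg (fun z => e.1 ≫ z) (E.act_div _ _ hp)
  simp only [E.comp_act, Category.comp_id] at h1
  rw [← Category.assoc, e.2, Category.id_comp] at h1
  have h2 : e.1 ≫ E.div (E.proj ≫ e.1) (𝟙 _) hp = 1 := by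
    apply E.act_cancel (x := e.1)
    rw [h1, E.act_one]
  rw [h2, E'.act_one]

/-- The unique isomorphism of bundles carrying a given section to a given section. -/
def frameIso {E E' : Bundle G T} (e : E.Section) (e' : E'.Section) : E ≅ E' where
  hom := frameHom e e'
  inv := frameHom e' e
  hom_inv_id := Subtype.ext <| isMap_ext (frameHom e e' ≫ frameHom e' e).2 (𝟙 E : E ⟶ E).2 e (by
    rw [comp_val, ← Category.assoc, comp_frameHom, comp_frameHom, id_val, Category.comp_id])
  inv_hom_id := Subtype.ext <| isMap_ext (frameHom e' e ≫ frameHom e e').2 (𝟙 E' : E' ⟶ E').2 e' (by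
    rw [comp_val, ← Category.assoc, comp_frameHom, comp_frameHom, id_val, Category.comp_id])

/-- The trivial bundle `T × G`. -/
def trivial (G : SchC) [GrpObj G] (T : SchC) : Bundle G T where
  total := T ⊗ G
  proj := fst T G
  act x g := lift (x ≫ fst T G) ((x ≫ snd T G) * g)
  comp_act u x g := by simp [comp_lift, MonObj.comp_mul]
  act_one x := by ext <;> simp
  act_mul x g h := by simp [mul_assoc]
  act_proj x g := by simp
  simply_transitive x y h := by
    refine ⟨(x ≫ snd T G)⁻¹ * (y ≫ snd T G), ?_, ?_⟩
    · apply CartesianMonoidalCategory.hom_ext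
      · simpa using h
      · simp
    · rintro g rfl
      simp
  locally_trivial := by
    refine ⟨T, 𝟙 T, lift (𝟙 T) 1, ⟨?_, ?_⟩, by simp⟩
    · change Etale (𝟙 T.left); infer_instance
    · change AlgebraicGeometry.Surjective (𝟙 T.left); infer_instance

/-- A subset of the functor of points of the total space of a bundle. -/
abbrev SubPoints (E : Bundle G T) := ∀ S : SchC, Set (S ⟶ E.total)

/-- Image of a subset of the functor of points under an isomorphism of bundles. -/
def SubPoints.map {E E' : Bundle G T} (F : E.SubPoints) (f : E ≅ E') : E'.SubPoints :=
  fun S => {x | x ≫ f.inv.1 ∈ F S}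

end Bundle

/-- A section of the flag bundle `E ×_G (G / B⁺)` of a principal bundle `E`, given by its inverse
image `F` in `E`, a reduction of the structure group of `E` to (the normalizer of) `B⁺`. For the
trivial bundle over a point, these are the cosets `g B⁺`, i.e. the Borel subgroups `g B⁺ g⁻¹`. -/
structure IsFlag (A : AdjointGroup) {T : SchC} (E : Bundle A.G T) (F : E.SubPoints) : Prop where
  comp_mem : ∀ {S S' : SchC} (u : S' ⟶ S) (x : S ⟶ E.total), x ∈ F S → u ≫ x ∈ F S'
  act_mem : ∀ {S : SchC} (x : S ⟶ E.total) (g : S ⟶ A.G), x ∈ F S → g ∈ A.N S → E.act x g ∈ F S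
  div_mem : ∀ {S : SchC} (x : S ⟶ E.total) (g : S ⟶ A.G), x ∈ F S → E.act x g ∈ F S → g ∈ A.N S
  local_mem : ∀ {S U : SchC} (u : U ⟶ S) (x : S ⟶ E.total), IsEtaleCover u → u ≫ x ∈ F U → x ∈ F S
  locally_nonempty : ∃ (U : SchC) (u : U ⟶ T) (s : U ⟶ E.total),
    IsEtaleCover u ∧ s ≫ E.proj = u ∧ s ∈ F U

/-- The flag `e B⁺` defined by a section `e` of a principal bundle. -/
def flagOf (A : AdjointGroup) {T : SchC} {E : Bundle A.G T} (e : E.Section) : E.SubPoints :=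
  fun S => {x | ∃ g ∈ A.N S, x = E.act (x ≫ E.proj ≫ e.1) g}

/-! ### Local systems and parallel transport -/

/-- A local system on `X` with values in a category `𝒞` (a locally constant, or flat, family of
objects): around every point `y`, there is a local trivialization `tr y z : fiber y ≅ fiber z`,
for `z` in a neighbourhood `dom y` of `y`, and the transition functions are locally constant: the
trivializations `tr y` and `tr z` agree near `z` up to the constant `tr y z`, when `z` is close
to `y`. Only the germ of `tr y` at `y` matters, see the definition of morphisms below. -/
structure LocalSystem (X : Type) [TopologicalSpace X] (𝒞 : Type*) [Category 𝒞] where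
  fiber : X → 𝒞
  dom : X → Set X
  dom_mem : ∀ y, dom y ∈ 𝓝 y
  tr : ∀ y z, z ∈ dom y → (fiber y ≅ fiber z)
  flat : ∀ y, ∀ᶠ z in 𝓝 y, ∀ hz : z ∈ dom y, ∀ᶠ w in 𝓝 z, ∀ (hw : w ∈ dom y) (hw' : w ∈ dom z),
    tr y z hz ≪≫ tr z w hw' = tr y w hw

namespace LocalSystem

variable {X : Type} [TopologicalSpace X] {𝒞 : Type*} [Category 𝒞] (L : LocalSystem X 𝒞)

lemma mem_dom (y : X) : y ∈ L.dom y := mem_of_mem_nhds (L.dom_mem y)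

lemma tr_self (y : X) : L.tr y y (L.mem_dom y) = Iso.refl _ := by
  have h := ((L.flat y).self_of_nhds (L.mem_dom y)).self_of_nhds (L.mem_dom y) (L.mem_dom y)
  have h' := congrArg (fun i => (L.tr y y (L.mem_dom y)).symm ≪≫ i) h
  simpa using h'

/-- A family `τ t : fiber (c 0) ≅ fiber (c t)` of flat isomorphisms along the path `c`: the
continuation of the identity of `fiber (c 0)` along `c`. -/
structure IsFlatAlong (c : C(I, X)) (τ : ∀ t, L.fiber (c 0) ≅ L.fiber (c t)) : Prop where
  zero : τ 0 = Iso.refl _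
  flat : ∀ t, ∀ᶠ s in 𝓝 t, ∀ h : c s ∈ L.dom (c t), τ t ≪≫ L.tr (c t) (c s) h = τ s

/-- A property of points of the unit interval which holds at all points close to `t` as soon as it
holds at one of them, for all `t`, holds everywhere if it holds at `0`. -/
lemma unitInterval_induction {P : I → Prop} (h0 : P 0)
    (h : ∀ t, ∃ U ∈ 𝓝 t, ∀ s ∈ U, ∀ s' ∈ U, P s → P s') (t : I) : P t := by
  have hc : IsClopen {t | P t} := by
    constructor
    · rw [← isOpen_compl_iff, isOpen_iff_mem_nhds]
      intro t ht
      obtain ⟨U, hU, hP⟩ := h t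
      exact mem_of_superset hU fun s hs hPs => ht (hP s hs t (mem_of_mem_nhds hU) hPs)
    · rw [isOpen_iff_mem_nhds]
      intro t ht
      obtain ⟨U, hU, hP⟩ := h t
      exact mem_of_superset hU fun s hs => hP t (mem_of_mem_nhds hU) s hs ht
  have := hc.eq_univ ⟨0, h0⟩
  exact (this ▸ Set.mem_univ t : t ∈ {t | P t})

lemma exists_isFlatAlong (c : C(I, X)) : ∃ τ, L.IsFlatAlong c τ := by
  let P : I → Prop := fun r => ∃ τ : ∀ t, t ≤ r → (L.fiber (c 0) ≅ L.fiber (c t)),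
    (∀ h, τ 0 h = Iso.refl _) ∧ ∀ t (ht : t ≤ r), ∀ᶠ s in 𝓝 t, ∀ (hs : s ≤ r)
      (h : c s ∈ L.dom (c t)), τ t ht ≪≫ L.tr (c t) (c s) h = τ s hs
  have key : ∀ r, P r := by
    intro r
    refine unitInterval_induction (P := P) ?_ ?_ r
    · have h0 : ∀ t : I, t ≤ 0 → t = 0 := fun t ht => le_antisymm ht t.2.1
      refine ⟨fun t ht => eqToIso (by rw [h0 t ht]), fun h => rfl, ?_⟩
      intro t ht
      obtain rfl := h0 t ht
      refine Eventually.of_forall ?_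
      intro s hs h
      obtain rfl := h0 s hs
      rw [L.tr_self]
      simp
    · intro t0
      have h1 : ∀ᶠ s in 𝓝 t0, c s ∈ L.dom (c t0) :=
        c.continuous.continuousAt.eventually (L.dom_mem (c t0))
      have h2 := c.continuous.continuousAt.eventually (L.flat (c t0))
      obtain ⟨ε, hε, hball⟩ := Metric.mem_nhds_iff.mp (h1.and h2)
      refine ⟨Metric.ball t0 ε, Metric.ball_mem_nhds _ hε, ?_⟩
      intro s hs s' hs' ⟨τ, hτ0, hτ⟩
      have hconv : ∀ u, s < u → u ≤ s' → u ∈ Metric.ball t0 ε := by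
        intro u hu hu'
        rw [Metric.mem_ball, Subtype.dist_eq, Real.dist_eq, abs_lt] at hs hs' ⊢
        have hu1 : (s : ℝ) < u := hu
        have hu2 : (u : ℝ) ≤ s' := hu'
        constructor <;> linarith [hs.1, hs'.2]
      refine ⟨fun t ht => if hts : t ≤ s then τ t hts else
        τ s le_rfl ≪≫ (L.tr (c t0) (c s) (hball hs).1).symm ≪≫
          L.tr (c t0) (c t) (hball (hconv t (not_le.mp hts) ht)).1, ?_, ?_⟩
      · intro h
        exact (dif_pos (show (0 : I) ≤ s from s.2.1)).trans (hτ0 _)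
      · intro t ht
        rcases lt_trichotomy t s with hlt | heq | hgt
        · filter_upwards [hτ t hlt.le, Iio_mem_nhds hlt] with u hu hus hu' h
          rw [dif_pos hlt.le, dif_pos (le_of_lt hus)]
          exact hu _ h
        · subst heq
          have h3 := c.continuous.continuousAt.eventually ((hball hs).2 (hball hs).1)
          filter_upwards [hτ t le_rfl, h3] with u hu h3 hu' h
          rw [dif_pos le_rfl]
          by_cases hut : u ≤ t
          · rw [dif_pos hut]
            exact hu _ h
          · rw [dif_neg hut, ← h3 (hball (hconv u (not_le.mp hut) hu')).1 h]
            simp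
        · have htb := hball (hconv t hgt ht)
          have h3 := c.continuous.continuousAt.eventually (htb.2 htb.1)
          filter_upwards [h3, Ioi_mem_nhds hgt] with u h3 hus hu' h
          rw [dif_neg (not_le.mpr hgt), dif_neg (not_le.mpr hus),
            ← h3 (hball (hconv u hus hu')).1 h]
          simp [Iso.trans_assoc]
  obtain ⟨τ, hτ0, hτ⟩ := key 1
  refine ⟨fun t => τ t t.2.2, hτ0 _, fun t => ?_⟩
  filter_upwards [hτ t t.2.2] with s hs h
  exact hs _ h

/-- Parallel transport along a path. -/
def transport (c : C(I, X)) : L.fiber (c 0) ≅ L.fiber (c 1) := (L.exists_isFlatAlong c).choose 1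

end LocalSystem

/-- Maps of local systems of principal bundles covering a map `b : T → T'` of the bases: families of
bundle maps which commute with the local trivializations. -/
structure IsLocalSystemMap {G : SchC} [GrpObj G] {X : Type} [TopologicalSpace X] {T T' : SchC}
    (b : T ⟶ T') (L : LocalSystem X (Bundle G T)) (L' : LocalSystem X (Bundle G T'))
    (f : ∀ y, (L.fiber y).total ⟶ (L'.fiber y).total) : Prop where
  isMap : ∀ y, Bundle.IsMap b (L.fiber y) (L'.fiber y) (f y)
  flat : ∀ y, ∀ᶠ z in 𝓝 y, ∀ (h : z ∈ L.dom y) (h' : z ∈ L'.dom y),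
    (L.tr y z h).hom.1 ≫ f z = f y ≫ (L'.tr y z h').hom.1

namespace IsLocalSystemMap

variable {G : SchC} [GrpObj G] {X : Type} [TopologicalSpace X] {T T' T'' : SchC}

lemma id (L : LocalSystem X (Bundle G T)) :
    IsLocalSystemMap (𝟙 T) L L (fun y => 𝟙 (L.fiber y).total) where
  isMap y := Bundle.IsMap.id _
  flat y := Eventually.of_forall fun z h h' => by simp

lemma comp {b : T ⟶ T'} {b' : T' ⟶ T''} {L : LocalSystem X (Bundle G T)}
    {L' : LocalSystem X (Bundle G T')} {L'' : LocalSystem X (Bundle G T'')}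
    {f : ∀ y, (L.fiber y).total ⟶ (L'.fiber y).total}
    {f' : ∀ y, (L'.fiber y).total ⟶ (L''.fiber y).total}
    (h : IsLocalSystemMap b L L' f) (h' : IsLocalSystemMap b' L' L'' f') :
    IsLocalSystemMap (b ≫ b') L L'' (fun y => f y ≫ f' y) where
  isMap y := (h.isMap y).comp (h'.isMap y)
  flat y := by
    filter_upwards [h.flat y, h'.flat y, L'.dom_mem y] with z h1 h2 h3 h4 h5
    rw [← Category.assoc, h1 h4 h3, Category.assoc, h2 h3 h5, Category.assoc]

lemma iso_hom_inv {E E' : Bundle G T} (i : E ≅ E') : i.hom.1 ≫ i.inv.1 = 𝟙 E.total :=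
  congrArg Subtype.val i.hom_inv_id

lemma iso_inv_hom {E E' : Bundle G T} (i : E ≅ E') : i.inv.1 ≫ i.hom.1 = 𝟙 E'.total :=
  congrArg Subtype.val i.inv_hom_id

lemma transport {b : T ⟶ T'} {L : LocalSystem X (Bundle G T)} {L' : LocalSystem X (Bundle G T')}
    {f : ∀ y, (L.fiber y).total ⟶ (L'.fiber y).total} (hf : IsLocalSystemMap b L L' f)
    (c : C(I, X)) : (L.transport c).hom.1 ≫ f (c 1) = f (c 0) ≫ (L'.transport c).hom.1 := by
  have hτ := (L.exists_isFlatAlong c).choose_spec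
  have hτ' := (L'.exists_isFlatAlong c).choose_spec
  set τ := (L.exists_isFlatAlong c).choose with hd
  set τ' := (L'.exists_isFlatAlong c).choose with hd'
  change (τ 1).hom.1 ≫ f (c 1) = f (c 0) ≫ (τ' 1).hom.1
  refine LocalSystem.unitInterval_induction
    (P := fun t => (τ t).hom.1 ≫ f (c t) = f (c 0) ≫ (τ' t).hom.1) ?_ ?_ 1
  · rw [hτ.zero, hτ'.zero]; simp
  · intro t
    refine ⟨{s | (τ s).hom.1 ≫ f (c s) = f (c 0) ≫ (τ' s).hom.1 ↔
      (τ t).hom.1 ≫ f (c t) = f (c 0) ≫ (τ' t).hom.1}, ?_, ?_⟩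
    · have h1 : ∀ᶠ s in 𝓝 t, c s ∈ L.dom (c t) :=
        c.continuous.continuousAt.eventually (L.dom_mem (c t))
      have h2 : ∀ᶠ s in 𝓝 t, c s ∈ L'.dom (c t) :=
        c.continuous.continuousAt.eventually (L'.dom_mem (c t))
      have h3 := c.continuous.continuousAt.eventually (hf.flat (c t))
      filter_upwards [h1, h2, h3, hτ.flat t, hτ'.flat t] with s h1 h2 h3 h4 h5
      rw [← h4 h1, ← h5 h2]
      simp only [Iso.trans_hom, Bundle.comp_val, Category.assoc]
      rw [h3 h1 h2]
      constructor
      · intro h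
        have h' := congrArg (fun i => i ≫ (L'.tr (c t) (c s) h2).inv.1) h
        simp only [Category.assoc, iso_hom_inv, Category.comp_id] at h'
        exact h'
      · intro h
        rw [← Category.assoc, h, Category.assoc]
    · intro s hs s' hs' h
      exact hs'.mpr (hs.mp h)

end IsLocalSystemMap

/-! ### Marked surfaces -/

/-- The half plane `{(x₀, x₁) | x₀ ≥ 0}` as a model for surfaces with boundary. -/
abbrev halfPlane : ModelWithCorners ℝ (EuclideanSpace ℝ (Fin 2)) (EuclideanHalfSpace 2) :=
  modelWithCornersEuclideanHalfSpace 2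

/-- A marked surface: a compact oriented smooth surface with boundary (possibly disconnected), with
a finite non-empty set of marked points meeting every boundary component. The orientation is given
by the atlas, whose transition maps preserve the orientation of the half plane. -/
structure MarkedSurface where
  carrier : Type
  [top : TopologicalSpace carrier]
  [t2 : T2Space carrier]
  [compact : CompactSpace carrier]
  [charted : ChartedSpace (EuclideanHalfSpace 2) carrier]
  smooth : IsManifold halfPlane ∞ carrier
  oriented : ∀ φ ∈ atlas (EuclideanHalfSpace 2) carrier,
    ∀ ψ ∈ atlas (EuclideanHalfSpace 2) carrier, ∀ x ∈ φ.source ∩ ψ.source,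
      0 < (fderivWithin ℝ (ψ.extend halfPlane ∘ (φ.extend halfPlane).symm) (Set.range halfPlane)
        (φ.extend halfPlane x)).det
  marked : Set carrier
  marked_finite : marked.Finite
  marked_nonempty : marked.Nonempty
  boundary_marked : ∀ x ∈ halfPlane.boundary carrier, ∃ m ∈ marked,
    m ∈ connectedComponentIn (halfPlane.boundary carrier) x

attribute [instance] MarkedSurface.top MarkedSurface.t2 MarkedSurface.compact MarkedSurface.charted

namespace MarkedSurface

/-- The complement of the marked points. -/
abbrev Open (M : MarkedSurface) : Type := {x : M.carrier // x ∉ M.marked}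

/-- The boundary points which are not marked, i.e. the union of the boundary intervals. -/
def bdry (M : MarkedSurface) : Set M.Open := {x | x.1 ∈ halfPlane.boundary M.carrier}

/-- The filter of punctured neighbourhoods of a marked point. -/
def near (M : MarkedSurface) (m : M.carrier) : Filter M.Open := comap Subtype.val (𝓝 m)

/-- A boundary interval, that is, a connected component of the complement of the marked points in
the boundary, with a parametrization by `(0, 1)` which is compatible with the orientation of the
boundary. The latter is such that the surface lies to the left: in an oriented chart with values in
the half plane `x₀ ≥ 0`, the coordinate `x₁` decreases. The initial and terminal special points of
the interval are the values of the parametrization at `0` and `1`. -/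
structure BoundaryInterval (M : MarkedSurface) where
  toFun : C(I, M.carrier)
  initial_mem : toFun 0 ∈ M.marked
  terminal_mem : toFun 1 ∈ M.marked
  notMem : ∀ t ∈ Set.Ioo (0 : I) 1, toFun t ∉ M.marked
  mem_boundary : ∀ t ∈ Set.Ioo (0 : I) 1, toFun t ∈ halfPlane.boundary M.carrier
  injOn : Set.InjOn toFun (Set.Ioo 0 1)
  positive : ∀ t ∈ Set.Ioo (0 : I) 1, ∀ φ ∈ atlas (EuclideanHalfSpace 2) M.carrier,
    toFun t ∈ φ.source → ∃ U ∈ 𝓝 t, StrictAntiOn (fun s => (φ (toFun s)).1 1) U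

namespace BoundaryInterval

variable {M : MarkedSurface} (E : M.BoundaryInterval)

/-- The point of the interval with parameter `t`. -/
def pt (t : Set.Ioo (0 : I) 1) : M.Open := ⟨E.toFun t, E.notMem t t.2⟩

lemma pt_mem (t : Set.Ioo (0 : I) 1) : E.pt t ∈ M.bdry := E.mem_boundary t t.2

lemma pt_injective : Function.Injective E.pt := fun t t' h =>
  Subtype.ext (E.injOn t.2 t'.2 (congrArg Subtype.val h))

/-- The set of points of the (open) boundary interval. -/
def points : Set M.Open := Set.range E.pt

lemma mem_bdry {x : M.Open} (hx : x ∈ E.points) : x ∈ M.bdry := by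
  obtain ⟨t, rfl⟩ := hx
  exact E.pt_mem t

end BoundaryInterval

end MarkedSurface

/-! ### The moduli stack of framed local systems with pinnings -/

/-- A framed `G`-local system with pinnings on `M`, over a scheme `T` (a family of such objects
parametrized by `T`).

* `L` is a family over `T` of `G`-local systems on the complement of the marked points.
* `framing` is a flat section of the flag bundle `L ×_G (G / B⁺)` near the marked points: only the
  values at the points close to the marked points matter.
* `pin` is a flat section of the bundle of pinnings `L ×_G 𝒫_G` over the boundary intervals. As the
  space of pinnings `𝒫_G` is a principal homogeneous space of `G` with base point `p_std`, a pinning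
  `e.p_std` is the same thing as the section `e` of `L`. The projections of the pinning `e.p_std`
  to the flags are `π₊ = e.B⁺` and `π₋ = e.B⁻ = (e w₀).B⁺`; at each boundary interval, they are
  the flags given by the framing at the initial and at the terminal special point. -/
structure ModuliObj (A : AdjointGroup) (M : MarkedSurface) where
  base : SchC
  L : LocalSystem M.Open (Bundle A.G base)
  framing : ∀ y, (L.fiber y).SubPoints
  framing_isFlag : ∀ m ∈ M.marked, ∀ᶠ y in M.near m, IsFlag A (L.fiber y) (framing y)
  framing_flat : ∀ m ∈ M.marked, ∀ᶠ y in M.near m, ∀ᶠ z in 𝓝 y, ∀ h : z ∈ L.dom y,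
    (framing y).map (L.tr y z h) = framing z
  pin : ∀ y ∈ M.bdry, (L.fiber y).Section
  pin_flat : ∀ (y : M.Open) (hy : y ∈ M.bdry), ∀ᶠ z in 𝓝 y, ∀ (hz : z ∈ M.bdry) (h : z ∈ L.dom y),
    (pin y hy).map (L.tr y z h).hom = pin z hz
  pin_initial : ∀ E : M.BoundaryInterval, ∀ᶠ t in comap Subtype.val (𝓝 (0 : I)),
    framing (E.pt t) = flagOf A (pin (E.pt t) (E.pt_mem t))
  pin_terminal : ∀ E : M.BoundaryInterval, ∀ᶠ t in comap Subtype.val (𝓝 (1 : I)),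
    framing (E.pt t) = flagOf A ((pin (E.pt t) (E.pt_mem t)).act (A.w0At base))

/-- Morphisms of framed local systems with pinnings covering a map of the bases: maps of local
systems of principal bundles under which the framings and the pinnings are the pulled back ones. -/
@[ext]
structure ModuliHom {A : AdjointGroup} {M : MarkedSurface} (P Q : ModuliObj A M) where
  base : P.base ⟶ Q.base
  map : ∀ y, (P.L.fiber y).total ⟶ (Q.L.fiber y).total
  isMap : IsLocalSystemMap base P.L Q.L map
  framing : ∀ m ∈ M.marked, ∀ᶠ y in M.near m, ∀ (S : SchC) (x : S ⟶ (P.L.fiber y).total),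
    x ∈ P.framing y S ↔ x ≫ map y ∈ Q.framing y S
  pin : ∀ (y : M.Open) (hy : y ∈ M.bdry), (P.pin y hy).1 ≫ map y = base ≫ (Q.pin y hy).1

instance (A : AdjointGroup) (M : MarkedSurface) : Category (ModuliObj A M) where
  Hom := ModuliHom
  id P :=
    { base := 𝟙 _
      map := fun y => 𝟙 _
      isMap := IsLocalSystemMap.id _
      framing := fun m _ => Eventually.of_forall fun y S x => by simp
      pin := fun y hy => by simp }
  comp f g :=
    { base := f.base ≫ g.base
      map := fun y => f.map y ≫ g.map y
      isMap := f.isMap.comp g.isMap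
      framing := fun m hm => by
        filter_upwards [f.framing m hm, g.framing m hm] with y h1 h2 S x
        rw [h1, h2, Category.assoc]
      pin := fun y hy => by
        rw [← Category.assoc, f.pin, Category.assoc, g.pin, Category.assoc] }
  id_comp f := by apply ModuliHom.ext <;> simp
  comp_id f := by apply ModuliHom.ext <;> simp
  assoc f g h := by apply ModuliHom.ext <;> simp

/-- The moduli stack `𝒫_{G,M}` of framed `G`-local systems with pinnings on `M`, as a category over
the category of schemes over `ℂ`. -/
def moduliStack (A : AdjointGroup) (M : MarkedSurface) : BasedCategory SchC where
  obj := ModuliObj A M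
  p := { obj := fun P => P.base, map := fun {P Q} (f : ModuliHom P Q) => f.base }

/-! ### The stacks `G` and `[G / Ad G]` -/

/-- An object of the quotient stack `[G / Ad G]`: a principal `G`-bundle with a `G`-equivariant map
to `G`, on which `G` acts by conjugation. -/
structure AdObj (G : SchC) [GrpObj G] where
  base : SchC
  bundle : Bundle G base
  map : bundle.total ⟶ G
  equivariant : ∀ {S : SchC} (x : S ⟶ bundle.total) (g : S ⟶ G),
    bundle.act x g ≫ map = g⁻¹ * (x ≫ map) * g

/-- A morphism of the quotient stack `[G / Ad G]`: a (Cartesian) square of principal bundles which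
respects the equivariant maps to `G`. -/
@[ext]
structure AdHom {G : SchC} [GrpObj G] (P Q : AdObj G) where
  base : P.base ⟶ Q.base
  map : P.bundle.total ⟶ Q.bundle.total
  isMap : Bundle.IsMap base P.bundle Q.bundle map
  comm : map ≫ Q.map = P.map

instance (G : SchC) [GrpObj G] : Category (AdObj G) where
  Hom := AdHom
  id P := ⟨𝟙 _, 𝟙 _, Bundle.IsMap.id _, by simp⟩
  comp f g := ⟨f.base ≫ g.base, f.map ≫ g.map, f.isMap.comp g.isMap, by
    rw [Category.assoc, g.comm, f.comm]⟩
  id_comp f := by apply AdHom.ext <;> simp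
  comp_id f := by apply AdHom.ext <;> simp
  assoc f g h := by apply AdHom.ext <;> simp

/-- The quotient stack `[G / Ad G]` of `G` by the conjugation action. -/
def adQuotient (G : SchC) [GrpObj G] : BasedCategory SchC where
  obj := AdObj G
  p := { obj := fun P => P.base, map := fun {P Q} (f : AdHom P Q) => f.base }

/-- The scheme `G` as a stack: its objects over `T` are the morphisms `T → G`. -/
def groupStack (G : SchC) [GrpObj G] : BasedCategory SchC where
  obj := Over G
  p := Over.forget G

/-- The canonical projection `G → [G / Ad G]`: a morphism `u : T → G` goes to the trivial bundle
`T × G` with the equivariant map `(t, h) ↦ h⁻¹ u(t) h`. -/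
def adProjection (G : SchC) [GrpObj G] : groupStack G ⟶ adQuotient G where
  obj (u : Over G) :=
    { base := u.left
      bundle := Bundle.trivial G u.left
      map := (snd u.left G)⁻¹ * (fst u.left G ≫ u.hom) * snd u.left G
      equivariant := by
        intro S (x : S ⟶ u.left ⊗ G) g
        change lift (x ≫ fst u.left G) ((x ≫ snd u.left G) * g) ≫
          ((snd u.left G)⁻¹ * (fst u.left G ≫ u.hom) * snd u.left G) =
          g⁻¹ * (x ≫ ((snd u.left G)⁻¹ * (fst u.left G ≫ u.hom) * snd u.left G)) * g
        simp [MonObj.comp_mul, GrpObj.comp_inv, mul_assoc] }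
  map {u v : Over G} (f : u ⟶ v) :=
    { base := f.left
      map := f.left ▷ G
      isMap := by
        constructor
        · change f.left ▷ G ≫ fst v.left G = fst u.left G ≫ f.left
          simp
        · intro S (x : S ⟶ u.left ⊗ G) g
          change lift (x ≫ fst u.left G) ((x ≫ snd u.left G) * g) ≫ f.left ▷ G =
            lift ((x ≫ f.left ▷ G) ≫ fst v.left G) (((x ≫ f.left ▷ G) ≫ snd v.left G) * g)
          simp
      comm := by
        change f.left ▷ G ≫ ((snd v.left G)⁻¹ * (fst v.left G ≫ v.hom) * snd v.left G) =
          (snd u.left G)⁻¹ * (fst u.left G ≫ u.hom) * snd u.left G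
        simp [MonObj.comp_mul, GrpObj.comp_inv] }
  map_id u := AdHom.ext rfl (MonoidalCategory.id_whiskerRight _ _)
  map_comp f g := AdHom.ext rfl (MonoidalCategory.comp_whiskerRight _ _ _)
  w := rfl

/-! ### Wilson lines and Wilson loops -/

namespace Bundle

variable {G : SchC} [GrpObj G] {T T' : SchC}

/-- The element `g` of `G(T)` with `e' = e g`, for two global sections `e`, `e'`. -/
def Section.div {E : Bundle G T} (e e' : E.Section) : T ⟶ G :=
  E.div e.1 e'.1 (e.2.trans e'.2.symm)

lemma Section.act_div {E : Bundle G T} (e e' : E.Section) : E.act e.1 (e.div e') = e'.1 :=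
  E.act_div _ _ _

lemma Section.div_comp {b : T ⟶ T'} {E : Bundle G T} {E' : Bundle G T'} {f : E.total ⟶ E'.total}
    (hf : IsMap b E E' f) (e₁ e₂ : E.Section) (e₁' e₂' : E'.Section)
    (h₁ : e₁.1 ≫ f = b ≫ e₁'.1) (h₂ : e₂.1 ≫ f = b ≫ e₂'.1) :
    e₁.div e₂ = b ≫ e₁'.div e₂' := by
  apply E'.act_cancel (x := b ≫ e₁'.1)
  rw [← E'.comp_act, Section.act_div, ← h₂, ← h₁, ← hf.act, Section.act_div]

/-- The equivariant map `E → G` given by an automorphism `a` of a principal bundle `E`: it is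
determined by `a x = x · (autMap a x)`. -/
def autMap {E : Bundle G T} (a : E ≅ E) : E.total ⟶ G :=
  E.div (𝟙 E.total) a.hom.1 (by rw [Category.id_comp, hom_proj])

lemma act_autMap {E : Bundle G T} (a : E ≅ E) {S : SchC} (x : S ⟶ E.total) :
    E.act x (x ≫ autMap a) = x ≫ a.hom.1 := by
  have h := congrArg (fun z => x ≫ z)
    (E.act_div (𝟙 E.total) a.hom.1 (by rw [Category.id_comp, hom_proj]))
  change E.act x (x ≫ E.div _ _ _) = _
  rw [E.comp_act, Category.comp_id] at h
  exact h

lemma autMap_equivariant {E : Bundle G T} (a : E ≅ E) {S : SchC} (x : S ⟶ E.total) (g : S ⟶ G) :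
    E.act x g ≫ autMap a = g⁻¹ * (x ≫ autMap a) * g := by
  apply E.act_cancel (x := E.act x g)
  rw [act_autMap, a.hom.2.act, ← act_autMap, ← E.act_mul, ← E.act_mul]
  simp [mul_assoc]

lemma autMap_comp {b : T ⟶ T'} {E : Bundle G T} {E' : Bundle G T'} {f : E.total ⟶ E'.total}
    (hf : IsMap b E E' f) (a : E ≅ E) (a' : E' ≅ E') (h : a.hom.1 ≫ f = f ≫ a'.hom.1) :
    f ≫ autMap a' = autMap a := by
  apply E'.act_cancel (x := f)
  rw [act_autMap, ← h]
  have h1 := act_autMap a (𝟙 E.total)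
  rw [Category.id_comp, Category.id_comp] at h1
  rw [← h1, hf.act, Category.id_comp]

end Bundle

section Wilson

variable (A : AdjointGroup) {M : MarkedSurface}

/-- The Wilson line along a path `c` from a boundary interval to a boundary interval, as a morphism
of stacks `g_c : 𝒫_{G,M} → G`. Continue the section `e_in` of `L` given by the pinning at the
initial interval along `c`, and let `h` be the element with `e_out = e_in h`, where `e_out` is
given by the pinning at the final interval. The value of the Wilson line is `h w₀`. Equivalently,
as `w₀² = 1` in `G`: when the pinning at the initial interval is `p_std`, the pinning at the final
interval is `(h w₀).p_std^*`. -/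
def wilsonLine (c : C(I, M.Open)) (h0 : c 0 ∈ M.bdry) (h1 : c 1 ∈ M.bdry) :
    moduliStack A M ⟶ groupStack A.G where
  obj (P : ModuliObj A M) := Over.mk
    ((((P.pin (c 0) h0).map (P.L.transport c).hom).div (P.pin (c 1) h1)) * A.w0At P.base)
  map {P Q : ModuliObj A M} (f : ModuliHom P Q) := Over.homMk f.base (by
    change f.base ≫ (_ * _) = _ * _
    rw [MonObj.comp_mul, A.comp_w0At]
    congr 1
    refine (Bundle.Section.div_comp (f.isMap.isMap (c 1)) _ _ _ _ ?_ (f.pin _ h1)).symm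
    change ((P.pin (c 0) h0).1 ≫ (P.L.transport c).hom.1) ≫ _ =
      f.base ≫ (Q.pin (c 0) h0).1 ≫ (Q.L.transport c).hom.1
    rw [Category.assoc, f.isMap.transport, ← Category.assoc, f.pin, Category.assoc])
  map_id P := rfl
  map_comp f g := rfl
  w := rfl

/-- The monodromy of a local system along a loop `γ`, as an automorphism of the fibre at the
base point of `γ`: a vector at the end of `γ` is transported backwards to the beginning. -/
def LocalSystem.monodromy {X : Type} [TopologicalSpace X] {𝒞 : Type*} [Category 𝒞]
    (L : LocalSystem X 𝒞) (γ : C(I, X)) (hγ : γ 1 = γ 0) : L.fiber (γ 0) ≅ L.fiber (γ 0) :=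
  (L.transport γ ≪≫ eqToIso (congrArg L.fiber hγ)).symm

/-- The Wilson loop along a loop `γ`, as a morphism of stacks `ρ_γ : 𝒫_{G,M} → [G / Ad G]`. It
sends `(L, β, p)` to the fibre of `L` at the base point, with the equivariant map to `G` which
sends a frame `s` to the matrix `ρ` of the monodromy of `L` along `γ` with respect to `s`. -/
def wilsonLoop (γ : C(I, M.Open)) (hγ : γ 1 = γ 0) : moduliStack A M ⟶ adQuotient A.G where
  obj (P : ModuliObj A M) :=
    { base := P.base
      bundle := P.L.fiber (γ 0)
      map := Bundle.autMap (P.L.monodromy γ hγ)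
      equivariant := Bundle.autMap_equivariant _ }
  map {P Q : ModuliObj A M} (f : ModuliHom P Q) :=
    { base := f.base
      map := f.map (γ 0)
      isMap := f.isMap.isMap (γ 0)
      comm := by
        apply Bundle.autMap_comp (f.isMap.isMap (γ 0))
        have key : ∀ (x : M.Open) (hx : γ 1 = x),
            (P.L.transport γ ≪≫ eqToIso (congrArg P.L.fiber hx)).inv.1 ≫ f.map (γ 0) =
            f.map x ≫ (Q.L.transport γ ≪≫ eqToIso (congrArg Q.L.fiber hx)).inv.1 := by
          rintro _ rfl
          have h := f.isMap.transport γ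
          simp only [eqToIso_refl, Iso.trans_refl]
          have h' := congrArg
            (fun z => (P.L.transport γ).inv.1 ≫ z ≫ (Q.L.transport γ).inv.1) h
          simp only [Category.assoc, IsLocalSystemMap.iso_hom_inv, Category.comp_id] at h'
          rw [← h', ← Category.assoc, IsLocalSystemMap.iso_inv_hom, Category.id_comp]
        exact key _ hγ }
  map_id P := rfl
  map_comp f g := rfl
  w := rfl

end Wilson

/-! ### Gluing -/

/-- Pull-back of a local system along a continuous map. -/
def LocalSystem.pullback {X Y : Type} [TopologicalSpace X] [TopologicalSpace Y] {𝒞 : Type*}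
    [Category 𝒞] (L : LocalSystem Y 𝒞) (f : C(X, Y)) : LocalSystem X 𝒞 where
  fiber x := L.fiber (f x)
  dom x := f ⁻¹' L.dom (f x)
  dom_mem x := f.continuous.continuousAt.preimage_mem_nhds (L.dom_mem (f x))
  tr x z hz := L.tr (f x) (f z) hz
  flat x := by
    filter_upwards [f.continuous.continuousAt.eventually (L.flat (f x))] with z h hz
    filter_upwards [f.continuous.continuousAt.eventually (h hz)] with w h hw hw'
    exact h hw hw'

/-- The marked surface `M'` is obtained from `M` by gluing the boundary intervals `E₁` and `E₂`:
there is a quotient map `M → M'` which identifies `E₁(t)` with `E₂(1 - t)`, for all `t`, and makes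
no further identifications. The marked points of `M'` are the images of those of `M`, the boundary
of `M'` is the image of the boundary of `M` with `E₁` and `E₂` removed, and the boundary intervals
of `M'` are images of (positively oriented) boundary intervals of `M`. -/
structure Gluing (M M' : MarkedSurface) where
  E₁ : M.BoundaryInterval
  E₂ : M.BoundaryInterval
  disjoint : Disjoint E₁.points E₂.points
  toFun : C(M.carrier, M'.carrier)
  surjective : Function.Surjective toFun
  eq_iff : ∀ x y, toFun x = toFun y ↔
    Relation.EqvGen (fun x y => ∃ t, x = E₁.toFun t ∧ y = E₂.toFun (unitInterval.symm t)) x y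
  mem_marked_iff : ∀ x, toFun x ∈ M'.marked ↔ x ∈ M.marked
  mem_boundary_iff : ∀ x : M.Open, toFun x.1 ∈ halfPlane.boundary M'.carrier ↔
    x ∈ M.bdry ∧ x ∉ E₁.points ∧ x ∉ E₂.points
  lift : ∀ E' : M'.BoundaryInterval, ∃ E : M.BoundaryInterval, ∀ t, toFun (E.toFun t) = E'.toFun t

namespace Gluing

variable {M M' : MarkedSurface} (g : Gluing M M')

/-- The quotient map on the complements of the marked points. -/
def map : C(M.Open, M'.Open) where
  toFun x := ⟨g.toFun x.1, fun h => x.2 ((g.mem_marked_iff x.1).mp h)⟩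
  continuous_toFun := (g.toFun.continuous.comp continuous_subtype_val).subtype_mk _

lemma map_mem_bdry_iff (x : M.Open) : g.map x ∈ M'.bdry ↔
    x ∈ M.bdry ∧ x ∉ g.E₁.points ∧ x ∉ g.E₂.points := g.mem_boundary_iff x

/-- The framed local system with pinnings `Q` on `M'` is obtained from the framed local system with
pinnings `P` on `M` by gluing: there is a map from the local system of `P` to the pull-back of the
local system of `Q` to `M`, respecting the framings and the pinnings, such that at each point
`E₁(t) = E₂(1 - t)` of the glued edge, the pinning `e₁.p_std` of `P` at `E₁` is identified with the
opposite `(e₂.p_std)^* = (e₂ w₀).p_std` of the pinning `e₂.p_std` of `P` at `E₂`. -/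
structure GluingMap {A : AdjointGroup} (P : ModuliObj A M) (Q : ModuliObj A M') where
  base : P.base ⟶ Q.base
  map : ∀ x, (P.L.fiber x).total ⟶ (Q.L.fiber (g.map x)).total
  isMap : IsLocalSystemMap base P.L (Q.L.pullback g.map) map
  framing : ∀ m ∈ M.marked, ∀ᶠ x in M.near m, ∀ (S : SchC) (s : S ⟶ (P.L.fiber x).total),
    s ∈ P.framing x S ↔ s ≫ map x ∈ Q.framing (g.map x) S
  pin : ∀ (x : M.Open) (hx : x ∈ M.bdry) (hx' : g.map x ∈ M'.bdry),
    (P.pin x hx).1 ≫ map x = base ≫ (Q.pin (g.map x) hx').1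
  glue : ∀ (t t' : Set.Ioo (0 : I) 1), (t' : I) = unitInterval.symm t →
    (⟨g.map (g.E₁.pt t), (P.pin (g.E₁.pt t) (g.E₁.pt_mem t)).1 ≫ map (g.E₁.pt t)⟩ :
      Σ y : M'.Open, P.base ⟶ (Q.L.fiber y).total) =
    ⟨g.map (g.E₂.pt t'),
      ((P.pin (g.E₂.pt t') (g.E₂.pt_mem t')).act (A.w0At P.base)).1 ≫ map (g.E₂.pt t')⟩

/-- A gluing morphism `q : 𝒫_{G,M} → 𝒫_{G,M'}`: a morphism of stacks which sends a framed local
system with pinnings on `M` to the one on `M'` obtained from it by gluing, naturally. -/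
structure GluingMorphism (A : AdjointGroup) where
  q : moduliStack A M ⟶ moduliStack A M'
  map : ∀ P : ModuliObj A M, g.GluingMap P (q.obj P)
  base_eq : ∀ P : ModuliObj A M, (map P).base = eqToHom (BasedFunctor.w_obj q P).symm
  naturality : ∀ {P Q : ModuliObj A M} (f : ModuliHom P Q) (x : M.Open),
    (map P).map x ≫ ModuliHom.map (q.map f) (g.map x) = f.map x ≫ (map Q).map x

end Gluing

/-! ### Construction of the gluing morphism -/

namespace Bundle

variable {A : AdjointGroup} {T : SchC}

lemma Section.ext' {G : SchC} [GrpObj G] {E : Bundle G T} {e e' : E.Section} (h : e.1 = e'.1) :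
    e = e' := Subtype.ext h

lemma hom_ext {G : SchC} [GrpObj G] {E E' : Bundle G T} {i j : E ≅ E'} (e : E.Section)
    (h : e.1 ≫ i.hom.1 = e.1 ≫ j.hom.1) : i = j :=
  Iso.ext (Subtype.ext (isMap_ext i.hom.2 j.hom.2 e h))

lemma Section.map_act {G : SchC} [GrpObj G] {E E' : Bundle G T} (e : E.Section) (a : T ⟶ G)
    (f : E ⟶ E') : (e.act a).map f = (e.map f).act a :=
  Subtype.ext (f.2.act _ _)

lemma SubPoints.map_trans {G : SchC} [GrpObj G] {E E' E'' : Bundle G T} (F : E.SubPoints)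
    (i : E ≅ E') (j : E' ≅ E'') : F.map (i ≪≫ j) = (F.map i).map j := by
  funext S
  ext x
  change x ≫ (j.inv ≫ i.inv).1 ∈ F S ↔ (x ≫ j.inv.1) ≫ i.inv.1 ∈ F S
  rw [comp_val, Category.assoc]

lemma SubPoints.map_refl {G : SchC} [GrpObj G] {E : Bundle G T} (F : E.SubPoints) :
    F.map (Iso.refl E) = F := by
  funext S
  ext x
  change x ≫ 𝟙 _ ∈ F S ↔ _
  rw [Category.comp_id]

lemma map_flagOf {E E' : Bundle A.G T} (e : E.Section) (i : E ≅ E') :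
    (flagOf A e).map i = flagOf A (e.map i.hom) := by
  have hp : ∀ {S : SchC} (x : S ⟶ E'.total), (x ≫ i.inv.1) ≫ E.proj = x ≫ E'.proj := by
    intro S x
    rw [Category.assoc, hom_proj]
  funext S
  ext x
  constructor
  · rintro ⟨n, hn, h⟩
    refine ⟨n, hn, ?_⟩
    have h' := congrArg (fun z => z ≫ i.hom.1) h
    rw [i.hom.2.act] at h'
    rw [Category.assoc, IsLocalSystemMap.iso_inv_hom, Category.comp_id] at h'
    rw [← Category.assoc, hp] at h'
    refine h'.trans ?_
    simp only [Category.assoc, Section.map]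
  · rintro ⟨n, hn, h⟩
    refine ⟨n, hn, ?_⟩
    have h' := congrArg (fun z => z ≫ i.inv.1) h
    rw [i.inv.2.act] at h'
    refine h'.trans ?_
    congr 1
    simp only [Section.map, Category.assoc, IsLocalSystemMap.iso_hom_inv, Category.comp_id]
    rw [← Category.assoc i.inv.1, hom_proj]

lemma flagOf_act_of_mem {E : Bundle A.G T} (e : E.Section) {n : T ⟶ A.G} (hn : n ∈ A.N T) :
    flagOf A (e.act n) = flagOf A e := by
  have key : ∀ {S : SchC} (x : S ⟶ E.total), x ≫ E.proj ≫ (e.act n).1 =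
      E.act (x ≫ E.proj ≫ e.1) (x ≫ E.proj ≫ n) := by
    intro S x
    simp only [Section.act, E.comp_act]
  funext S
  ext x
  have hx : x ≫ E.proj ≫ n ∈ A.N S := by
    rw [← Category.assoc]
    exact A.N_comp _ hn
  constructor
  · rintro ⟨m, hm, h⟩
    refine ⟨(x ≫ E.proj ≫ n) * m, mul_mem hx hm, ?_⟩
    rw [E.act_mul, ← key]
    exact h
  · rintro ⟨m, hm, h⟩
    refine ⟨(x ≫ E.proj ≫ n)⁻¹ * m, mul_mem (inv_mem hx) hm, ?_⟩
    rw [key, ← E.act_mul, mul_inv_cancel_left]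
    exact h

end Bundle

namespace Gluing

variable {M M' : MarkedSurface} (g : Gluing M M')

lemma isClosed_points (E : M.BoundaryInterval) : IsClosed E.points := by
  have h : E.points = Subtype.val ⁻¹' Set.range E.toFun := by
    ext x
    constructor
    · rintro ⟨t, rfl⟩
      exact ⟨t, rfl⟩
    · rintro ⟨t, ht⟩
      have h0 : t ≠ 0 := by
        rintro rfl
        exact x.2 (ht ▸ E.initial_mem)
      have h1 : t ≠ 1 := by
        rintro rfl
        exact x.2 (ht ▸ E.terminal_mem)
      exact ⟨⟨t, lt_of_le_of_ne t.2.1 h0.symm, lt_of_le_of_ne t.2.2 h1⟩, Subtype.ext ht⟩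
  rw [h]
  exact (isCompact_range E.toFun.continuous).isClosed.preimage continuous_subtype_val

/-- The symmetry of the open unit interval. -/
def symm' (t : Set.Ioo (0 : I) 1) : Set.Ioo (0 : I) 1 :=
  ⟨unitInterval.symm t, by
    constructor
    · have h := unitInterval.strictAnti_symm t.2.2
      rwa [unitInterval.symm_one] at h
    · have h := unitInterval.strictAnti_symm t.2.1
      rwa [unitInterval.symm_zero] at h⟩

/-- The points `x` of `E₁` and `y` of `E₂` are identified. -/
def Twin (x y : M.Open) : Prop := ∃ t, x = g.E₁.pt t ∧ y = g.E₂.pt (symm' t)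

lemma Twin.left {x y : M.Open} (h : g.Twin x y) : x ∈ g.E₁.points := by
  obtain ⟨t, rfl, rfl⟩ := h; exact ⟨t, rfl⟩

lemma Twin.right {x y : M.Open} (h : g.Twin x y) : y ∈ g.E₂.points := by
  obtain ⟨t, rfl, rfl⟩ := h; exact ⟨_, rfl⟩

lemma symm'_injective : Function.Injective symm' := by
  intro t t' h
  have := congrArg Subtype.val h
  exact Subtype.ext (unitInterval.symm_bijective.injective this)

lemma notMem_both {x : M.Open} (h : x ∈ g.E₁.points) (h' : x ∈ g.E₂.points) : False :=
  Set.disjoint_left.mp g.disjoint h h'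

lemma Twin.unique_right {x y z : M.Open} (h : g.Twin x y) (h' : g.Twin x z) : y = z := by
  obtain ⟨t, rfl, rfl⟩ := h
  obtain ⟨t', h1, rfl⟩ := h'
  rw [g.E₁.pt_injective h1]

lemma Twin.unique_left {x y z : M.Open} (h : g.Twin x z) (h' : g.Twin y z) : x = y := by
  obtain ⟨t, rfl, rfl⟩ := h
  obtain ⟨t', rfl, h1⟩ := h'
  rw [symm'_injective (g.E₂.pt_injective h1)]

lemma cases_eq {x y : M.Open} (h : g.map x = g.map y) : x = y ∨ g.Twin x y ∨ g.Twin y x := by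
  have h1 := (g.eq_iff x.1 y.1).mp (congrArg Subtype.val h)
  have key : ∀ {a b : M.carrier}, Relation.EqvGen (fun x y => ∃ t, x = g.E₁.toFun t ∧
      y = g.E₂.toFun (unitInterval.symm t)) a b → (a ∈ M.marked ∧ b ∈ M.marked) ∨
      ∃ x y : M.Open, x.1 = a ∧ y.1 = b ∧ (x = y ∨ g.Twin x y ∨ g.Twin y x) := by
    intro a b hab
    induction hab with
    | rel a b hab =>
      obtain ⟨t, rfl, rfl⟩ := hab
      by_cases h0 : t = 0
      · subst h0
        left
        exact ⟨g.E₁.initial_mem, by rw [unitInterval.symm_zero]; exact g.E₂.terminal_mem⟩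
      by_cases h1 : t = 1
      · subst h1
        left
        exact ⟨g.E₁.terminal_mem, by rw [unitInterval.symm_one]; exact g.E₂.initial_mem⟩
      right
      have ht : t ∈ Set.Ioo (0 : I) 1 :=
        ⟨lt_of_le_of_ne t.2.1 (Ne.symm h0), lt_of_le_of_ne t.2.2 h1⟩
      exact ⟨g.E₁.pt ⟨t, ht⟩, g.E₂.pt (symm' ⟨t, ht⟩), rfl, rfl, Or.inr (Or.inl ⟨_, rfl, rfl⟩)⟩
    | refl a =>
      by_cases h : a ∈ M.marked
      · exact Or.inl ⟨h, h⟩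
      · exact Or.inr ⟨⟨a, h⟩, ⟨a, h⟩, rfl, rfl, Or.inl rfl⟩
    | symm a b _ ih =>
      rcases ih with h | ⟨x, y, rfl, rfl, h⟩
      · exact Or.inl h.symm
      · exact Or.inr ⟨y, x, rfl, rfl, by tauto⟩
    | trans a b c _ _ ih ih' =>
      rcases ih with h | ⟨x, y, rfl, rfl, h⟩
      · rcases ih' with h' | ⟨y, z, rfl, rfl, h'⟩
        · exact Or.inl ⟨h.1, h'.2⟩
        · exact (y.2 h.2).elim
      · rcases ih' with h' | ⟨y', z, hy, rfl, h'⟩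
        · exact (y.2 h'.1).elim
        · obtain rfl : y' = y := Subtype.ext hy
          refine Or.inr ⟨x, z, rfl, rfl, ?_⟩
          rcases h with rfl | h | h
          · exact h'
          · rcases h' with rfl | h' | h'
            · exact Or.inr (Or.inl h)
            · exact (g.notMem_both h'.left h.right).elim
            · exact Or.inl (h.unique_left g h')
          · rcases h' with rfl | h' | h'
            · exact Or.inr (Or.inr h)
            · exact Or.inl (h.unique_right g h')
            · exact (g.notMem_both h.left h'.right).elim
  rcases key h1 with h2 | ⟨x', y', hx, hy, h2⟩
  · exact (x.2 h2.1).elim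
  · obtain rfl : x' = x := Subtype.ext hx
    obtain rfl : y' = y := Subtype.ext hy
    exact h2

lemma map_eq_of_twin {x y : M.Open} (h : g.Twin x y) : g.map x = g.map y := by
  obtain ⟨t, rfl, rfl⟩ := h
  exact Subtype.ext ((g.eq_iff _ _).mpr (Relation.EqvGen.rel _ _ ⟨t, rfl, rfl⟩))

lemma map_surjective : Function.Surjective g.map := by
  intro y
  obtain ⟨x, hx⟩ := g.surjective y.1
  exact ⟨⟨x, fun h => y.2 (hx ▸ (g.mem_marked_iff x).mpr h)⟩, Subtype.ext hx⟩

lemma isClosedMap_toFun : IsClosedMap g.toFun := g.toFun.continuous.isClosedMap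

lemma isClosedMap_map : IsClosedMap g.map := by
  intro C hC
  obtain ⟨D, hD, rfl⟩ := isClosed_induced_iff.mp hC
  have : g.map '' (Subtype.val ⁻¹' D) = Subtype.val ⁻¹' (g.toFun '' D) := by
    ext y
    constructor
    · rintro ⟨x, hx, rfl⟩
      exact ⟨x.1, hx, rfl⟩
    · rintro ⟨x, hx, hxy⟩
      exact ⟨⟨x, fun h => y.2 (hxy ▸ (g.mem_marked_iff x).mpr h)⟩, hx, Subtype.ext hxy⟩
  rw [this]
  exact (g.isClosedMap_toFun D hD).preimage continuous_subtype_val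

/-- A property holds over all points close to `y` if it holds close to the points over `y`. -/
lemma eventually_fiber {p : M.Open → Prop} (y : M'.Open)
    (h : ∀ x, g.map x = y → ∀ᶠ w in 𝓝 x, p w) : ∀ᶠ z in 𝓝 y, ∀ w, g.map w = z → p w :=
  g.isClosedMap_map.eventually_nhds_fiber y h

lemma eventually_near {p : M.Open → Prop} {m' : M'.carrier} (hm : m' ∈ M'.marked)
    (h : ∀ m ∈ M.marked, ∀ᶠ x in M.near m, p x) :
    ∀ᶠ z in M'.near m', ∀ x, g.map x = z → p x := by
  have h1 := g.isClosedMap_toFun.eventually_nhds_fiber (p := fun b => ∀ x : M.Open, x.1 = b → p x)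
    m' (by
      rintro m rfl
      exact eventually_comap.mp (h m ((g.mem_marked_iff m).mp hm)))
  refine eventually_comap.mpr (h1.mono ?_)
  rintro b hb z rfl x rfl
  exact hb x.1 rfl x rfl

lemma near_nhds {p : M.Open → Prop} {m : M.carrier} (h : ∀ᶠ x in M.near m, p x) :
    ∀ᶠ x in M.near m, ∀ᶠ w in 𝓝 x, p w := by
  have h1 := eventually_eventually_nhds.mpr (eventually_comap.mp h)
  refine eventually_comap.mpr (h1.mono ?_)
  rintro b hb x rfl
  exact (continuous_subtype_val.continuousAt.eventually hb).mono fun w hw => hw w rfl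

/-- A choice of preimages under the quotient map. -/
def rep (y : M'.Open) : M.Open := (g.map_surjective y).choose

lemma map_rep (y : M'.Open) : g.map (g.rep y) = y := (g.map_surjective y).choose_spec

lemma map_rep' (x : M.Open) : g.map x = g.map (g.rep (g.map x)) := (g.map_rep _).symm

lemma eq_of_notMem {x y : M.Open} (h : g.map x = g.map y) (h1 : x ∉ g.E₁.points)
    (h2 : x ∉ g.E₂.points) : x = y := by
  rcases g.cases_eq h with h | h | h
  · exact h
  · exact (h1 h.left).elim
  · exact (h2 h.right).elim

/-- Neighbourhoods which separate the points which are identified. -/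
lemma exists_separated : ∃ U : M.Open → Set M.Open, (∀ x, U x ∈ 𝓝 x) ∧
    ∀ x x', g.map x = g.map x' → x ≠ x' → Disjoint (U x) (U x') := by
  have hfin : ∀ y : M'.Open, {x | g.map x = y}.Finite := by
    intro y
    refine Set.Finite.subset (s := {g.rep y} ∪ ({x | g.Twin x (g.rep y)} ∪ {x | g.Twin (g.rep y) x}))
      ((Set.finite_singleton _).union (Set.Finite.union
        (Set.Subsingleton.finite fun a ha b hb => ha.unique_left g hb)
        (Set.Subsingleton.finite fun a ha b hb => ha.unique_right g hb))) ?_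
    intro x hx
    have := g.cases_eq (x := x) (y := g.rep y) (by rw [g.map_rep]; exact hx)
    simpa using this
  choose V hV hV' using fun y => (hfin y).t2_separation
  refine ⟨fun x => V (g.map x) x, fun x => (hV _ x).2.mem_nhds (hV _ x).1, ?_⟩
  intro x x' h hne
  have := hV' (g.map x) (show x ∈ {z | g.map z = g.map x} from rfl)
    (show x' ∈ {z | g.map z = g.map x} from h.symm) hne
  change Disjoint (V (g.map x) x) (V (g.map x') x')
  rw [← h]
  exact this

/-- The union of the two intervals to be glued. -/
def edges : Set M.Open := g.E₁.points ∪ g.E₂.points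

lemma edges_subset {x : M.Open} (hx : x ∈ g.edges) : x ∈ M.bdry := by
  rcases hx with ⟨t, rfl⟩ | ⟨t, rfl⟩
  · exact g.E₁.pt_mem t
  · exact g.E₂.pt_mem t

section Obj

variable {A : AdjointGroup} (P : ModuliObj A M)

open Classical in
/-- The sections of the local system along the intervals `E₁`, `E₂` which are to be identified. -/
def hat (x : M.Open) (hx : x ∈ g.edges) : (P.L.fiber x).Section :=
  if x ∈ g.E₂.points then (P.pin x (g.edges_subset hx)).act (A.w0At P.base)
  else P.pin x (g.edges_subset hx)

lemma mem_edges_of_ne {x y : M.Open} (h : g.map x = g.map y) (hne : x ≠ y) : x ∈ g.edges := by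
  rcases g.cases_eq h with h | h | h
  · exact (hne h).elim
  · exact Or.inl h.left
  · exact Or.inr h.right

open Classical in
/-- The identification of the fibres at two points `x`, `y` with the same image. -/
def ident (x y : M.Open) (h : g.map x = g.map y) : P.L.fiber x ≅ P.L.fiber y :=
  if hxy : x = y then eqToIso (congrArg P.L.fiber hxy)
  else Bundle.frameIso (g.hat P x (g.mem_edges_of_ne h hxy))
    (g.hat P y (g.mem_edges_of_ne h.symm (Ne.symm hxy)))

lemma ident_self (x : M.Open) : g.ident P x x rfl = Iso.refl _ := by
  rw [ident, dif_pos rfl]; rfl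

lemma hat_ident (x y : M.Open) (h : g.map x = g.map y) (hx : x ∈ g.edges) (hy : y ∈ g.edges) :
    (g.hat P x hx).1 ≫ (g.ident P x y h).hom.1 = (g.hat P y hy).1 := by
  by_cases hxy : x = y
  · subst hxy
    rw [ident_self]
    exact Category.comp_id _
  · rw [ident, dif_neg hxy]
    exact Bundle.comp_frameHom _ _

lemma ident_trans (x y z : M.Open) (h : g.map x = g.map y) (h' : g.map y = g.map z) :
    g.ident P x y h ≪≫ g.ident P y z h' = g.ident P x z (h.trans h') := by
  by_cases hxy : x = y
  · subst hxy
    rw [ident_self, Iso.refl_trans]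
  by_cases hyz : y = z
  · subst hyz
    rw [ident_self, Iso.trans_refl]
  have hx := g.mem_edges_of_ne h hxy
  have hy := g.mem_edges_of_ne h' hyz
  have hz := g.mem_edges_of_ne h'.symm (Ne.symm hyz)
  apply Bundle.hom_ext (g.hat P x hx)
  rw [Iso.trans_hom, Bundle.comp_val, ← Category.assoc, hat_ident g P x y h hx hy,
    hat_ident g P y z h' hy hz, hat_ident g P x z _ hx hz]

/-- The pairs `x`, `w` with `w` in a sufficiently small neighbourhood of `x`. -/
structure Close (U : M.Open → Set M.Open) (x w : M.Open) : Prop where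
  mem_dom : w ∈ P.L.dom x
  mem : w ∈ U x
  left : w ∈ g.E₁.points → x ∈ g.E₁.points
  right : w ∈ g.E₂.points → x ∈ g.E₂.points
  hat : ∀ (hx : x ∈ g.edges) (hw : w ∈ g.edges),
    (g.hat P x hx).1 ≫ (P.L.tr x w mem_dom).hom.1 = (g.hat P w hw).1

lemma eventually_close (U : M.Open → Set M.Open) (hU : ∀ x, U x ∈ 𝓝 x) (x : M.Open) :
    ∀ᶠ w in 𝓝 x, g.Close P U x w := by
  have hcl : ∀ E : M.BoundaryInterval, ∀ᶠ w in 𝓝 x, w ∈ E.points → x ∈ E.points := by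
    intro E
    by_cases hx : x ∈ E.points
    · exact Eventually.of_forall fun _ _ => hx
    · filter_upwards [(isClosed_points E).isOpen_compl.mem_nhds hx] with w hw hw'
      exact (hw hw').elim
  have hpin : ∀ᶠ w in 𝓝 x, ∀ (hx : x ∈ M.bdry) (hw : w ∈ M.bdry) (h : w ∈ P.L.dom x),
      (P.pin x hx).map (P.L.tr x w h).hom = P.pin w hw := by
    by_cases hx : x ∈ M.bdry
    · exact (P.pin_flat x hx).mono fun w hw _ => hw
    · exact Eventually.of_forall fun w h => (hx h).elim
  filter_upwards [P.L.dom_mem x, hU x, hcl g.E₁, hcl g.E₂, hpin] with w h1 h2 h3 h4 h5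
  refine ⟨h1, h2, h3, h4, ?_⟩
  intro hx hw
  have h6 := h5 (g.edges_subset hx) (g.edges_subset hw) h1
  have hiff : x ∈ g.E₂.points ↔ w ∈ g.E₂.points := by
    refine ⟨fun h => ?_, h4⟩
    rcases hw with hw | hw
    · exact (g.notMem_both (h3 hw) h).elim
    · exact hw
  unfold Gluing.hat
  by_cases hx2 : x ∈ g.E₂.points
  · rw [if_pos hx2, if_pos (hiff.mp hx2), ← h6, ← Bundle.Section.map_act]
    rfl
  · rw [if_neg hx2, if_neg (fun h => hx2 (hiff.mpr h)), ← h6]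
    rfl

/-- The compatibility of the local trivializations upstairs and downstairs. -/
def Compat (U : M.Open → Set M.Open) (y z : M'.Open)
    (τ : P.L.fiber (g.rep y) ≅ P.L.fiber (g.rep z)) : Prop :=
  ∀ (x w : M.Open) (hx : g.map x = y) (hw : g.map w = z) (h : g.Close P U x w),
    g.ident P x (g.rep y) (hx.trans (g.map_rep y).symm) ≪≫ τ =
      P.L.tr x w h.mem_dom ≪≫ g.ident P w (g.rep z) (hw.trans (g.map_rep z).symm)

lemma exists_compat (U : M.Open → Set M.Open)
    (hU : ∀ x x', g.map x = g.map x' → x ≠ x' → Disjoint (U x) (U x')) (x w : M.Open)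
    (h : g.Close P U x w) : ∃ τ, g.Compat P U (g.map x) (g.map w) τ := by
  refine ⟨g.ident P _ x (g.map_rep _) ≪≫ P.L.tr x w h.mem_dom ≪≫ g.ident P w _ (g.map_rep' w), ?_⟩
  intro x₂ w₂ hx hw h₂
  suffices hs : g.ident P x₂ x hx ≪≫ P.L.tr x w h.mem_dom =
      P.L.tr x₂ w₂ h₂.mem_dom ≪≫ g.ident P w₂ w hw by
    have hs' := congrArg (fun i => i ≪≫ g.ident P w _ (g.map_rep' w)) hs
    simp only [Iso.trans_assoc] at hs'
    rw [← g.ident_trans P w₂ w _ hw (g.map_rep' w), ← hs', ← Iso.trans_assoc, g.ident_trans]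
  by_cases hww : w₂ = w
  · subst hww
    by_cases hxx : x₂ = x
    · subst hxx
      rw [ident_self, ident_self, Iso.refl_trans, Iso.trans_refl]
    · exact (Set.disjoint_left.mp (hU x₂ x hx hxx) h₂.mem h.mem).elim
  · have e1 := g.mem_edges_of_ne hw hww
    have e2 := g.mem_edges_of_ne hw.symm (Ne.symm hww)
    have e3 : x₂ ∈ g.edges := e1.imp h₂.left h₂.right
    have e4 : x ∈ g.edges := e2.imp h.left h.right
    apply Bundle.hom_ext (g.hat P x₂ e3)
    rw [Iso.trans_hom, Iso.trans_hom, Bundle.comp_val, Bundle.comp_val, ← Category.assoc,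
      ← Category.assoc, g.hat_ident P x₂ x hx e3 e4, h.hat e4 e2, h₂.hat e3 e1,
      g.hat_ident P w₂ w hw e1 e2]

/-- The neighbourhoods which are used in the construction. -/
def sep : M.Open → Set M.Open := g.exists_separated.choose

/-- The domains of the local trivializations of the glued local system. -/
def dom' (y : M'.Open) : Set M'.Open := {z | ∃ τ, g.Compat P g.sep y z τ}

/-- The local trivializations of the glued local system. -/
def tr' (y z : M'.Open) (hz : z ∈ g.dom' P y) : P.L.fiber (g.rep y) ≅ P.L.fiber (g.rep z) :=
  hz.choose

/-- The identification of the fibre at `x` with the fibre of the glued local system. -/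
abbrev toRep (x : M.Open) : P.L.fiber x ≅ P.L.fiber (g.rep (g.map x)) :=
  g.ident P x _ (g.map_rep' x)

lemma tr'_spec (x w : M.Open) (hz : g.map w ∈ g.dom' P (g.map x)) (h : g.Close P g.sep x w) :
    g.toRep P x ≪≫ g.tr' P (g.map x) (g.map w) hz = P.L.tr x w h.mem_dom ≪≫ g.toRep P w :=
  hz.choose_spec x w rfl rfl h

lemma eventually_tr' (x : M.Open) : ∀ᶠ w in 𝓝 x, g.map w ∈ g.dom' P (g.map x) ∧
    g.Close P g.sep x w ∧ ∀ (hz : g.map w ∈ g.dom' P (g.map x)) (h : w ∈ P.L.dom x),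
    g.toRep P x ≪≫ g.tr' P (g.map x) (g.map w) hz = P.L.tr x w h ≪≫ g.toRep P w := by
  filter_upwards [g.eventually_close P g.sep g.exists_separated.choose_spec.1 x] with w hw
  exact ⟨g.exists_compat P g.sep g.exists_separated.choose_spec.2 x w hw, hw,
    fun hz h => g.tr'_spec P x w hz hw⟩

/-- The glued local system. -/
def glueL : LocalSystem M'.Open (Bundle A.G P.base) where
  fiber y := P.L.fiber (g.rep y)
  dom := g.dom' P
  dom_mem y := by
    have h := g.eventually_fiber (p := fun w => g.map w ∈ g.dom' P y) y (by
      rintro x rfl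
      exact (g.eventually_tr' P x).mono fun w hw => hw.1)
    filter_upwards [h] with z hz
    have := hz (g.rep z) (g.map_rep z)
    rwa [g.map_rep] at this
  tr := g.tr' P
  flat y := by
    have h := g.eventually_fiber (p := fun z => ∀ hz : g.map z ∈ g.dom' P y, ∀ᶠ w in 𝓝 z,
        ∀ (hw : g.map w ∈ g.dom' P y) (hw' : g.map w ∈ g.dom' P (g.map z)),
        g.tr' P y (g.map z) hz ≪≫ g.tr' P (g.map z) (g.map w) hw' = g.tr' P y (g.map w) hw) y (by
      rintro x rfl
      filter_upwards [g.eventually_tr' P x, eventually_eventually_nhds.mpr (g.eventually_tr' P x),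
        P.L.flat x] with z h1 h2 h3 hz
      filter_upwards [h2, g.eventually_tr' P z, h3 h1.2.1.mem_dom] with w h4 h5 h6 hw hw'
      have e1 := h1.2.2 hz h1.2.1.mem_dom
      have e2 := h4.2.2 hw h4.2.1.mem_dom
      have e3 := h5.2.2 hw' h5.2.1.mem_dom
      have e4 := h6 h4.2.1.mem_dom h5.2.1.mem_dom
      have e5 : g.toRep P x ≪≫ (g.tr' P (g.map x) (g.map z) hz ≪≫
          g.tr' P (g.map z) (g.map w) hw') = g.toRep P x ≪≫ g.tr' P (g.map x) (g.map w) hw := by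
        rw [← Iso.trans_assoc, e1, Iso.trans_assoc, e3, ← Iso.trans_assoc, e4, e2]
      have e6 := congrArg (fun i => (g.toRep P x).symm ≪≫ i) e5
      simpa only [Iso.symm_self_id_assoc] using e6)
    filter_upwards [h] with z hz h1
    have h2 := g.eventually_fiber (p := fun w => ∀ (hw : g.map w ∈ g.dom' P y)
        (hw' : g.map w ∈ g.dom' P z),
        g.tr' P y z h1 ≪≫ g.tr' P z (g.map w) hw' = g.tr' P y (g.map w) hw) z (by
      rintro x rfl
      exact hz x rfl h1)
    filter_upwards [h2] with w hw
    obtain ⟨w, rfl⟩ := g.map_surjective w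
    exact hw w rfl

lemma isLocalSystemMap_toRep : IsLocalSystemMap (𝟙 P.base) P.L ((g.glueL P).pullback g.map)
    (fun x => (g.toRep P x).hom.1) where
  isMap x := (g.toRep P x).hom.2
  flat x := by
    filter_upwards [g.eventually_tr' P x] with w hw h h'
    exact (congrArg (fun i => i.hom.1) (hw.2.2 h' h)).symm

lemma pin_ident {x y : M.Open} (hxy : x = y) (h : g.map x = g.map y) (hx : x ∈ M.bdry)
    (hy : y ∈ M.bdry) : (P.pin x hx).map (g.ident P x y h).hom = P.pin y hy := by
  subst hxy
  rw [ident_self]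
  exact Subtype.ext (Category.comp_id _)

lemma framing_ident_self {x y : M.Open} (hxy : x = y) (h : g.map x = g.map y) :
    (P.framing x).map (g.ident P x y h) = P.framing y := by
  subst hxy
  rw [ident_self, Bundle.SubPoints.map_refl]

lemma framing_ident_of_flagOf {x y : M.Open} (h : g.map x = g.map y) (hx : x ∈ g.edges)
    (hy : y ∈ g.edges) (c : P.base ⟶ A.G) (h1 : P.framing x = flagOf A ((g.hat P x hx).act c))
    (h2 : P.framing y = flagOf A ((g.hat P y hy).act c)) :
    (P.framing x).map (g.ident P x y h) = P.framing y := by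
  rw [h1, h2, Bundle.map_flagOf, Bundle.Section.map_act]
  congr 2
  exact Subtype.ext (g.hat_ident P x y h hx hy)

lemma hat_left (t : Set.Ioo (0 : I) 1) (h : g.E₁.pt t ∈ g.edges) :
    g.hat P (g.E₁.pt t) h = P.pin (g.E₁.pt t) (g.E₁.pt_mem t) :=
  if_neg fun h' => g.notMem_both ⟨t, rfl⟩ h'

lemma hat_right (t : Set.Ioo (0 : I) 1) (h : g.E₂.pt t ∈ g.edges) :
    g.hat P (g.E₂.pt t) h = (P.pin (g.E₂.pt t) (g.E₂.pt_mem t)).act (A.w0At P.base) :=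
  if_pos ⟨t, rfl⟩

lemma act_one' {G T : SchC} [GrpObj G] {E : Bundle G T} (e : E.Section) : e.act 1 = e :=
  Subtype.ext (E.act_one _)

lemma act_act {G T : SchC} [GrpObj G] {E : Bundle G T} (e : E.Section) (a b : T ⟶ G) :
    (e.act a).act b = e.act (a * b) :=
  Subtype.ext (E.act_mul _ _ _).symm

lemma left_mem (t : Set.Ioo (0 : I) 1) : g.E₁.pt t ∈ g.edges := Or.inl ⟨t, rfl⟩

lemma right_mem (t : Set.Ioo (0 : I) 1) : g.E₂.pt t ∈ g.edges := Or.inr ⟨t, rfl⟩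

/-- The parameters of the glued edge at which the framings are given by the pinnings. -/
def GoodParam (t : Set.Ioo (0 : I) 1) : Prop := ∃ c : P.base ⟶ A.G,
  P.framing (g.E₁.pt t) = flagOf A ((g.hat P (g.E₁.pt t) (g.left_mem t)).act c) ∧
  P.framing (g.E₂.pt (symm' t)) = flagOf A ((g.hat P (g.E₂.pt (symm' t)) (g.right_mem _)).act c)

lemma goodParam_zero : ∀ᶠ t in comap Subtype.val (𝓝 (0 : I)), g.GoodParam P t := by
  have h1 := P.pin_initial g.E₁
  have h2 : Tendsto symm' (comap Subtype.val (𝓝 (0 : I))) (comap Subtype.val (𝓝 (1 : I))) := by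
    rw [tendsto_comap_iff]
    have : Tendsto unitInterval.symm (𝓝 (0 : I)) (𝓝 1) := by
      have := unitInterval.continuous_symm.tendsto (0 : I)
      rwa [unitInterval.symm_zero] at this
    exact this.comp tendsto_comap
  filter_upwards [h1, h2.eventually (P.pin_terminal g.E₂)] with t h3 h4
  refine ⟨1, ?_, ?_⟩
  · rw [hat_left, act_one', h3]
  · rw [hat_right, act_one', h4]

lemma goodParam_one : ∀ᶠ t in comap Subtype.val (𝓝 (1 : I)), g.GoodParam P t := by
  have h1 := P.pin_terminal g.E₁
  have h2 : Tendsto symm' (comap Subtype.val (𝓝 (1 : I))) (comap Subtype.val (𝓝 (0 : I))) := by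
    rw [tendsto_comap_iff]
    have : Tendsto unitInterval.symm (𝓝 (1 : I)) (𝓝 0) := by
      have := unitInterval.continuous_symm.tendsto (1 : I)
      rwa [unitInterval.symm_one] at this
    exact this.comp tendsto_comap
  filter_upwards [h1, h2.eventually (P.pin_initial g.E₂)] with t h3 h4
  refine ⟨A.w0At P.base, ?_, ?_⟩
  · rw [hat_left, h3]
  · rw [hat_right, act_act, Bundle.flagOf_act_of_mem _ (A.w0_sq_mem P.base), h4]

lemma eventually_goodParam (E : M.BoundaryInterval) (p : Set.Ioo (0 : I) 1 → Prop)
    (h0 : ∀ᶠ t in comap Subtype.val (𝓝 (0 : I)), p t)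
    (h1 : ∀ᶠ t in comap Subtype.val (𝓝 (1 : I)), p t) (m : M.carrier) (hm : m ∈ M.marked) :
    ∀ᶠ x in M.near m, ∀ t, x = E.pt t → p t := by
  rw [eventually_comap] at h0 h1
  obtain ⟨U, hU, hUo, hU0⟩ := eventually_nhds_iff.mp h0
  obtain ⟨V, hV, hVo, hV0⟩ := eventually_nhds_iff.mp h1
  have hK : IsCompact (E.toFun '' (U ∪ V)ᶜ) :=
    ((hUo.union hVo).isClosed_compl.isCompact).image E.toFun.continuous
  have hm' : m ∉ E.toFun '' (U ∪ V)ᶜ := by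
    rintro ⟨t, ht, rfl⟩
    refine E.notMem t ⟨lt_of_le_of_ne t.2.1 ?_, lt_of_le_of_ne t.2.2 ?_⟩ hm
    · rintro h
      exact ht (Or.inl ((show t = 0 from h.symm) ▸ hU0))
    · rintro h
      exact ht (Or.inr ((show t = 1 from h) ▸ hV0))
  have hev : ∀ᶠ b in 𝓝 m, b ∉ E.toFun '' (U ∪ V)ᶜ := hK.isClosed.isOpen_compl.mem_nhds hm'
  refine eventually_comap.mpr (hev.mono ?_)
  rintro b hb x rfl t rfl
  by_cases ht : (t : I) ∈ U ∪ V
  · rcases ht with ht | ht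
    · exact hU _ ht _ rfl
    · exact hV _ ht _ rfl
  · exact (hb ⟨t, ht, rfl⟩).elim

lemma framing_ident (m : M.carrier) (hm : m ∈ M.marked) : ∀ᶠ x in M.near m,
    ∀ (y : M.Open) (h : g.map x = g.map y), (P.framing x).map (g.ident P x y h) = P.framing y := by
  have hs0 : ∀ᶠ t in comap Subtype.val (𝓝 (0 : I)), g.GoodParam P (symm' t) := by
    have h2 : Tendsto symm' (comap Subtype.val (𝓝 (0 : I))) (comap Subtype.val (𝓝 (1 : I))) := by
      rw [tendsto_comap_iff]
      have : Tendsto unitInterval.symm (𝓝 (0 : I)) (𝓝 1) := by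
        have := unitInterval.continuous_symm.tendsto (0 : I)
        rwa [unitInterval.symm_zero] at this
      exact this.comp tendsto_comap
    exact h2.eventually (g.goodParam_one P)
  have hs1 : ∀ᶠ t in comap Subtype.val (𝓝 (1 : I)), g.GoodParam P (symm' t) := by
    have h2 : Tendsto symm' (comap Subtype.val (𝓝 (1 : I))) (comap Subtype.val (𝓝 (0 : I))) := by
      rw [tendsto_comap_iff]
      have : Tendsto unitInterval.symm (𝓝 (1 : I)) (𝓝 0) := by
        have := unitInterval.continuous_symm.tendsto (1 : I)
        rwa [unitInterval.symm_one] at this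
      exact this.comp tendsto_comap
    exact h2.eventually (g.goodParam_zero P)
  have hss : ∀ t, symm' (symm' t) = t := fun t => Subtype.ext (unitInterval.symm_symm _)
  filter_upwards [eventually_goodParam g.E₁ _ (g.goodParam_zero P) (g.goodParam_one P) m hm,
    eventually_goodParam g.E₂ _ hs0 hs1 m hm] with x h1 h2 y h
  rcases g.cases_eq h with hxy | ⟨t, rfl, rfl⟩ | ⟨t, rfl, rfl⟩
  · exact g.framing_ident_self P hxy h
  · obtain ⟨c, hc, hc'⟩ := h1 t rfl
    exact g.framing_ident_of_flagOf P h _ _ c hc hc'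
  · have h3 := h2 _ rfl
    rw [hss] at h3
    obtain ⟨c, hc, hc'⟩ := h3
    exact g.framing_ident_of_flagOf P h _ _ c hc' hc

lemma rep_map_of_bdry {x : M.Open} (h : g.map x ∈ M'.bdry) : x = g.rep (g.map x) := by
  have h' := (g.map_mem_bdry_iff x).mp h
  exact g.eq_of_notMem (g.map_rep' x) h'.2.1 h'.2.2

lemma rep_mem_bdry {y : M'.Open} (hy : y ∈ M'.bdry) : g.rep y ∈ M.bdry :=
  ((g.map_mem_bdry_iff (g.rep y)).mp (by rwa [g.map_rep])).1

/-- The glued framed local system with pinnings. -/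
def glueObj : ModuliObj A M' where
  base := P.base
  L := g.glueL P
  framing y := P.framing (g.rep y)
  framing_isFlag m hm := by
    filter_upwards [g.eventually_near hm P.framing_isFlag] with y hy
    exact hy _ (g.map_rep y)
  framing_flat m hm := by
    have h := g.eventually_near hm (p := fun x => ∀ᶠ w in 𝓝 x,
        ∀ h : g.map w ∈ g.dom' P (g.map x), (P.framing (g.rep (g.map x))).map
          (g.tr' P (g.map x) (g.map w) h) = P.framing (g.rep (g.map w))) (by
      intro m hm
      filter_upwards [P.framing_flat m hm, g.framing_ident P m hm,
        near_nhds (g.framing_ident P m hm)] with x h1 h2 h3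
      filter_upwards [h1, h3, g.eventually_tr' P x] with w h4 h5 h6 h
      rw [← h2 _ (g.map_rep' x), ← Bundle.SubPoints.map_trans, h6.2.2 h h6.2.1.mem_dom,
        Bundle.SubPoints.map_trans, h4, h5])
    filter_upwards [h] with y hy
    have h2 := g.eventually_fiber (p := fun w => ∀ h : g.map w ∈ g.dom' P y,
        (P.framing (g.rep y)).map (g.tr' P y (g.map w) h) = P.framing (g.rep (g.map w))) y (by
      rintro x rfl
      exact hy x rfl)
    filter_upwards [h2] with z hz
    obtain ⟨w, rfl⟩ := g.map_surjective z
    exact hz w rfl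
  pin y hy := P.pin (g.rep y) (g.rep_mem_bdry hy)
  pin_flat y hy := by
    have h2 := g.eventually_fiber (p := fun w => ∀ (hw : g.map w ∈ M'.bdry)
        (h : g.map w ∈ g.dom' P y), (P.pin (g.rep y) (g.rep_mem_bdry hy)).map
          (g.tr' P y (g.map w) h).hom = P.pin (g.rep (g.map w)) (g.rep_mem_bdry hw)) y (by
      rintro x rfl
      have hx := ((g.map_mem_bdry_iff x).mp hy).1
      filter_upwards [P.pin_flat x hx, g.eventually_tr' P x] with w h4 h6 hw h
      have hw' := ((g.map_mem_bdry_iff w).mp hw).1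
      have h7 := congrArg (fun i => (P.pin x hx).map i.hom) (h6.2.2 h h6.2.1.mem_dom)
      have e1 : (P.pin x hx).map (g.toRep P x ≪≫ g.tr' P (g.map x) (g.map w) h).hom =
          ((P.pin x hx).map (g.toRep P x).hom).map (g.tr' P (g.map x) (g.map w) h).hom :=
        Subtype.ext (Category.assoc _ _ _).symm
      have e2 : (P.pin x hx).map (P.L.tr x w h6.2.1.mem_dom ≪≫ g.toRep P w).hom =
          ((P.pin x hx).map (P.L.tr x w h6.2.1.mem_dom).hom).map (g.toRep P w).hom :=
        Subtype.ext (Category.assoc _ _ _).symm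
      have h8 := e1.symm.trans (h7.trans e2)
      rw [h4 hw', g.pin_ident P (g.rep_map_of_bdry hy) _ hx (g.rep_mem_bdry hy),
        g.pin_ident P (g.rep_map_of_bdry hw) _ hw' (g.rep_mem_bdry hw)] at h8
      exact h8)
    filter_upwards [h2] with z hz
    obtain ⟨w, rfl⟩ := g.map_surjective z
    exact hz w rfl
  pin_initial E' := by
    obtain ⟨E, hE⟩ := g.lift E'
    have hpt : ∀ t, E'.pt t = g.map (E.pt t) := fun t => Subtype.ext (hE t).symm
    filter_upwards [P.pin_initial E] with t ht
    have key : ∀ y (hy : y ∈ M.bdry), E.pt t = y → P.framing y = flagOf A (P.pin y hy) := by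
      rintro _ _ rfl
      exact ht
    apply key
    rw [hpt]
    exact g.rep_map_of_bdry (by rw [← hpt]; exact E'.pt_mem t)
  pin_terminal E' := by
    obtain ⟨E, hE⟩ := g.lift E'
    have hpt : ∀ t, E'.pt t = g.map (E.pt t) := fun t => Subtype.ext (hE t).symm
    filter_upwards [P.pin_terminal E] with t ht
    have key : ∀ y (hy : y ∈ M.bdry), E.pt t = y →
        P.framing y = flagOf A ((P.pin y hy).act (A.w0At P.base)) := by
      rintro _ _ rfl
      exact ht
    apply key
    rw [hpt]
    exact g.rep_map_of_bdry (by rw [← hpt]; exact E'.pt_mem t)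

/-- The canonical map to the glued framed local system with pinnings. -/
def glueObjMap : g.GluingMap P (g.glueObj P) where
  base := 𝟙 _
  map x := (g.toRep P x).hom.1
  isMap := g.isLocalSystemMap_toRep P
  framing m hm := by
    filter_upwards [g.framing_ident P m hm] with x hx S s
    have h := hx _ (g.map_rep' x)
    change _ ↔ s ≫ (g.toRep P x).hom.1 ∈ P.framing (g.rep (g.map x)) S
    rw [← h]
    change s ∈ P.framing x S ↔ (s ≫ (g.toRep P x).hom.1) ≫ (g.toRep P x).inv.1 ∈ P.framing x S
    rw [Category.assoc, IsLocalSystemMap.iso_hom_inv, Category.comp_id]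
  pin x hx hx' := by
    refine Eq.trans ?_ (Category.id_comp (P.pin (g.rep (g.map x)) (g.rep_mem_bdry hx')).1).symm
    exact congrArg Subtype.val (g.pin_ident P (g.rep_map_of_bdry hx') (g.map_rep' x) hx
      (g.rep_mem_bdry hx'))
  glue t t' h := by
    obtain rfl : t' = symm' t := Subtype.ext h
    have h1 : g.E₁.pt t ∈ g.edges := Or.inl ⟨t, rfl⟩
    have h2 : g.E₂.pt (symm' t) ∈ g.edges := Or.inr ⟨_, rfl⟩
    have hm := g.map_eq_of_twin ⟨t, rfl, rfl⟩
    have key : ∀ (x x' : M.Open) (hx : x ∈ g.edges) (hx' : x' ∈ g.edges) (h : g.map x = g.map x'),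
        (⟨g.map x, (g.hat P x hx).1 ≫ (g.toRep P x).hom.1⟩ :
          Σ y : M'.Open, P.base ⟶ ((g.glueL P).fiber y).total) =
        ⟨g.map x', (g.hat P x' hx').1 ≫ (g.toRep P x').hom.1⟩ := by
      intro x x' hx hx' h
      have e : ∀ (y : M'.Open) (hy : g.map x = y),
          (⟨g.map x, (g.hat P x hx).1 ≫ (g.toRep P x).hom.1⟩ :
            Σ y : M'.Open, P.base ⟶ ((g.glueL P).fiber y).total) =
          ⟨y, (g.hat P x hx).1 ≫ (g.ident P x (g.rep y) (hy.trans (g.map_rep y).symm)).hom.1⟩ := by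
        rintro _ rfl
        rfl
      rw [e _ h, ← g.hat_ident P x x' h hx hx']
      congr 1
      have e1 := congrArg (fun i => (g.hat P x hx).1 ≫ i.hom.1)
        (g.ident_trans P x x' _ h (g.map_rep' x'))
      exact e1.symm.trans (Category.assoc _ _ _).symm
    have h3 := key _ _ h1 h2 hm
    rw [hat_left, hat_right] at h3
    exact h3

end Obj

section Mor

variable {A : AdjointGroup} {P Q : ModuliObj A M} (f : ModuliHom P Q)

lemma hat_natural (x : M.Open) (hx : x ∈ g.edges) :
    (g.hat P x hx).1 ≫ f.map x = f.base ≫ (g.hat Q x hx).1 := by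
  unfold hat
  split_ifs
  · change (P.L.fiber x).act _ _ ≫ _ = _ ≫ (Q.L.fiber x).act _ _
    rw [(f.isMap.isMap x).act, f.pin, (Q.L.fiber x).comp_act, A.comp_w0At]
  · exact f.pin x _

lemma ident_natural (x y : M.Open) (h : g.map x = g.map y) :
    (g.ident P x y h).hom.1 ≫ f.map y = f.map x ≫ (g.ident Q x y h).hom.1 := by
  by_cases hxy : x = y
  · subst hxy
    rw [ident_self, ident_self]
    change 𝟙 _ ≫ _ = _ ≫ 𝟙 _
    rw [Category.id_comp, Category.comp_id]
  have hx := g.mem_edges_of_ne h hxy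
  have hy := g.mem_edges_of_ne h.symm (Ne.symm hxy)
  have m1 := (g.ident P x y h).hom.2.comp (f.isMap.isMap y)
  have m2 := (f.isMap.isMap x).comp (g.ident Q x y h).hom.2
  rw [Category.id_comp] at m1
  rw [Category.comp_id] at m2
  apply Bundle.isMap_ext m1 m2 (g.hat P x hx)
  rw [← Category.assoc, g.hat_ident P x y h hx hy, g.hat_natural f, ← Category.assoc,
    g.hat_natural f, Category.assoc, g.hat_ident Q x y h hx hy]

/-- The gluing of a morphism. -/
def glueHom : ModuliHom (g.glueObj P) (g.glueObj Q) where
  base := f.base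
  map y := f.map (g.rep y)
  isMap := by
    refine ⟨fun y => f.isMap.isMap (g.rep y), fun y => ?_⟩
    have h2 := g.eventually_fiber (p := fun w => ∀ (h : g.map w ∈ g.dom' P y)
        (h' : g.map w ∈ g.dom' Q y), (g.tr' P y (g.map w) h).hom.1 ≫ f.map (g.rep (g.map w)) =
          f.map (g.rep y) ≫ (g.tr' Q y (g.map w) h').hom.1) y (by
      rintro x rfl
      filter_upwards [g.eventually_tr' P x, g.eventually_tr' Q x, f.isMap.flat x] with w h1 h2 h3 h h'
      have e1 := congrArg (fun i => i.hom.1) (h1.2.2 h h1.2.1.mem_dom)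
      have e2 := congrArg (fun i => i.hom.1) (h2.2.2 h' h2.2.1.mem_dom)
      simp only [Iso.trans_hom, Bundle.comp_val] at e1 e2
      have e3 := h3 h1.2.1.mem_dom h2.2.1.mem_dom
      have e4 : (g.toRep P x).hom.1 ≫ (g.tr' P (g.map x) (g.map w) h).hom.1 ≫
          f.map (g.rep (g.map w)) = (g.toRep P x).hom.1 ≫ f.map (g.rep (g.map x)) ≫
          (g.tr' Q (g.map x) (g.map w) h').hom.1 := by
        rw [← Category.assoc, e1, Category.assoc, g.ident_natural f, ← Category.assoc, e3,
          Category.assoc, ← e2, ← Category.assoc, ← g.ident_natural f, Category.assoc]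
      have e5 := congrArg (fun i => (g.toRep P x).inv.1 ≫ i) e4
      simpa only [← Category.assoc, IsLocalSystemMap.iso_inv_hom, Category.id_comp] using e5)
    filter_upwards [h2] with z hz
    obtain ⟨w, rfl⟩ := g.map_surjective z
    exact hz w rfl
  framing m hm := by
    filter_upwards [g.eventually_near hm f.framing] with y hy
    exact hy _ (g.map_rep y)
  pin y hy := f.pin (g.rep y) (g.rep_mem_bdry hy)

end Mor

/-- The gluing morphism. -/
def gluingMorphism (A : AdjointGroup) : g.GluingMorphism A where
  q :=
    { obj := fun P : ModuliObj A M => g.glueObj P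
      map := fun {P Q} (f : ModuliHom P Q) => g.glueHom f
      map_id := fun _ => rfl
      map_comp := fun _ _ => rfl
      w := rfl }
  map P := g.glueObjMap P
  base_eq _ := rfl
  naturality f x := g.ident_natural f x _ _

/-! ### Arcs and loops -/

/-- Two arcs from `E₁` to `E₂` in the same arc class: they are homotopic through arcs from `E₁`
to `E₂`. -/
def ArcHomotopic (c c' : C(I, M.Open)) : Prop :=
  ∃ K : C(I × I, M.Open), (∀ t, K (0, t) = c t) ∧ (∀ t, K (1, t) = c' t) ∧
    ∀ s, K (s, 0) ∈ g.E₁.points ∧ K (s, 1) ∈ g.E₂.points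

/-- The loop `γ` on `M'` represents the free loop arising from the arc class of the arc `c` from
`E₁` to `E₂`: it is freely homotopic to the image of an arc in the class of `c` whose end points
are identified in `M'`. -/
def LoopFromArc (c : C(I, M.Open)) (γ : C(I, M'.Open)) : Prop :=
  ∃ c' : C(I, M.Open), g.ArcHomotopic c c' ∧ g.map (c' 0) = g.map (c' 1) ∧
    ∃ K : C(I × I, M'.Open), (∀ t, K (0, t) = γ t) ∧ (∀ t, K (1, t) = g.map (c' t)) ∧
      ∀ s, K (s, 0) = K (s, 1)

end Gluing

end WilsonLines

end

noncomputable section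

namespace WilsonLines

/-! Let `c` be an arc whose end points are identified by the gluing, let `e₁` and `e₂` be the frames
of the local system given by the pinnings at its beginning and its end, and let `τ` be parallel
transport along `c`. If `e₂ = τ(e₁) h`, the Wilson line has the value `u = h w₀`, and equivariance
of `τ` gives `τ(e₁ u) = e₂ w₀` (`act_linePoint`). The gluing identifies `e₁` with `e₂ w₀`, so
transport once around the loop in `M'` takes `e₁ u` to `e₁`. The monodromy transports backwards and
therefore takes `e₁` to `e₁ u`: its matrix in the frame `e₁` is exactly `u`
(`baseSection_monodromy`).

The frame `e₁` also trivializes the bundle underlying the Wilson loop, namely the fibre of the glued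
local system at the base point. An equivariant map to `G` is determined by its value on one section
(`comp_equivariant`), so this trivialization carries the map `(t, h) ↦ h⁻¹ u(t) h` of the canonical
projection to the monodromy map. Morphisms of framed local systems respect pinnings, hence the
frames `e₁`, hence the trivializations are natural and form a 2-isomorphism
(`wilsonLine_iso_wilsonLoop`).

A general pair of arc and loop is reduced to this case by homotopy invariance. Its source is
`transport_square`: transport along two adjacent sides of a square agrees with transport along the
other two. Wilson lines of homotopic arcs are equal, because pinnings are flat along the boundary
(`wilsonLine_eq_of_homotopic`). Wilson loops of freely homotopic loops are only isomorphic, by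
transport along the track of the base point, which conjugates one monodromy into the other
(`wilsonLoop_iso_of_homotopic`). -/

/-- The path `s ↦ K (s, t)` in a map from the square. -/
def horizontal {X : Type} [TopologicalSpace X] (K : C(I × I, X)) (t : I) : C(I, X) where
  toFun s := K (s, t)

/-- The path `t ↦ K (s, t)` in a map from the square. -/
def vertical {X : Type} [TopologicalSpace X] (K : C(I × I, X)) (s : I) : C(I, X) where
  toFun t := K (s, t)

/-! ### Uniqueness and homotopy invariance of parallel transport. -/

namespace LocalSystem

variable {X : Type} [TopologicalSpace X] {𝒞 : Type*} [Category 𝒞] (L : LocalSystem X 𝒞)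

/-- The flat continuation of the identity of `fiber (c 0)` along `c`. -/
def continuation (c : C(I, X)) (t : I) : L.fiber (c 0) ≅ L.fiber (c t) :=
  (L.exists_isFlatAlong c).choose t

lemma isFlatAlong_continuation (c : C(I, X)) : L.IsFlatAlong c (L.continuation c) :=
  (L.exists_isFlatAlong c).choose_spec

/-- Flat families of isomorphisms along a path which agree at the beginning agree everywhere. -/
lemma eq_of_flat {Z : 𝒞} (c : C(I, X)) {τ τ' : ∀ t, Z ≅ L.fiber (c t)}
    (h : ∀ t, ∀ᶠ s in 𝓝 t, ∀ h : c s ∈ L.dom (c t), τ t ≪≫ L.tr (c t) (c s) h = τ s)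
    (h' : ∀ t, ∀ᶠ s in 𝓝 t, ∀ h : c s ∈ L.dom (c t), τ' t ≪≫ L.tr (c t) (c s) h = τ' s)
    (h0 : τ 0 = τ' 0) (t : I) : τ t = τ' t := by
  refine unitInterval_induction (P := fun t => τ t = τ' t) h0 (fun t => ?_) t
  -- The neighbourhood consists of the `s` at which the claim is equivalent to the claim at `t`, so
  -- its truth passes from `s` to `s'` through `t`. Near `t` both families change by the same
  -- isomorphism `tr`, which can be cancelled.
  refine ⟨{s | τ s = τ' s ↔ τ t = τ' t}, ?_, fun s hs s' hs' e => hs'.mpr (hs.mp e)⟩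
  filter_upwards [c.continuous.continuousAt.eventually (L.dom_mem (c t)), h t, h' t] with s h1 h2 h3
  rw [← h2 h1, ← h3 h1]
  constructor
  · intro e
    have e' := congrArg (fun i => i ≪≫ (L.tr (c t) (c s) h1).symm) e
    simpa using e'
  · intro e
    rw [e]

/-- Transport is defined through a chosen flat family; by uniqueness of continuation, any other flat
family computes it as well. -/
lemma transport_eq_of_isFlatAlong {c : C(I, X)} {τ : ∀ t, L.fiber (c 0) ≅ L.fiber (c t)}
    (h : L.IsFlatAlong c τ) : L.transport c = τ 1 :=
  L.eq_of_flat c (L.isFlatAlong_continuation c).flat h.flat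
    ((L.isFlatAlong_continuation c).zero.trans h.zero.symm) 1

/-- The trivializations of the pull-back along `c` are literally those of `L` along the image path,
so the same family of isomorphisms is flat for both. -/
lemma transport_pullback {Y : Type} [TopologicalSpace Y] (f : C(Y, X)) (c : C(I, Y)) :
    (L.pullback f).transport c = L.transport (f.comp c) :=
  (L.transport_eq_of_isFlatAlong (c := f.comp c) (τ := (L.pullback f).continuation c)
    ⟨((L.pullback f).isFlatAlong_continuation c).zero,
      ((L.pullback f).isFlatAlong_continuation c).flat⟩).symm

/-- Continue the identity along the side `t = 0` up to `s`, then along the path `t ↦ K (s, t)`. The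
result is flat in `t` by construction; the content is that it is also flat in `s` at every height
`t`. This spreads from height `0` to all heights because, over a small box in the square, one
trivialization serves all points, and in it the continuation does not depend on `t`. -/
lemma flat_vertical_continuation (K : C(I × I, X)) (s₀ t : I) :
    ∀ᶠ s in 𝓝 s₀, ∀ h : K (s, t) ∈ L.dom (K (s₀, t)),
      (L.continuation (horizontal K 0) s₀ ≪≫ L.continuation (vertical K s₀) t) ≪≫
        L.tr (K (s₀, t)) (K (s, t)) h =
      L.continuation (horizontal K 0) s ≪≫ L.continuation (vertical K s) t := by
  let F : ∀ s t, L.fiber (K (0, 0)) ≅ L.fiber (K (s, t)) := fun s t =>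
    L.continuation (horizontal K 0) s ≪≫ L.continuation (vertical K s) t
  have hF0 : ∀ s, F s 0 = L.continuation (horizontal K 0) s := fun s => by
    have e := (L.isFlatAlong_continuation (vertical K s)).zero
    exact (congrArg (fun i => L.continuation (horizontal K 0) s ≪≫ i) e).trans (Iso.trans_refl _)
  have hFflat : ∀ s t, ∀ᶠ t' in 𝓝 t, ∀ h : K (s, t') ∈ L.dom (K (s, t)),
      F s t ≪≫ L.tr (K (s, t)) (K (s, t')) h = F s t' := fun s t => by
    filter_upwards [(L.isFlatAlong_continuation (vertical K s)).flat t] with t' ht' h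
    have e := ht' h
    exact (Iso.trans_assoc _ _ _).trans
      (congrArg (fun i => L.continuation (horizontal K 0) s ≪≫ i) e)
  refine unitInterval_induction (P := fun t => ∀ᶠ s in 𝓝 s₀, ∀ h : K (s, t) ∈ L.dom (K (s₀, t)),
    F s₀ t ≪≫ L.tr (K (s₀, t)) (K (s, t)) h = F s t) ?_ (fun t₀ => ?_) t
  -- At height `0` the vertical continuation is the identity, so only flatness along the side `t =
  -- 0` is needed.
  · filter_upwards [(L.isFlatAlong_continuation (horizontal K 0)).flat s₀] with s hs h
    rw [hF0, hF0]
    exact hs h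
  set y := K (s₀, t₀) with hy
  have hV : ∀ᶠ z in 𝓝 y, ∃ hz : z ∈ L.dom y, ∀ᶠ w in 𝓝 z, ∀ (hw : w ∈ L.dom y)
      (hw' : w ∈ L.dom z), L.tr y z hz ≪≫ L.tr z w hw' = L.tr y w hw := by
    filter_upwards [L.dom_mem y, L.flat y] with z h1 h2
    exact ⟨h1, h2 h1⟩
  -- By continuity of `K`, the trivialization at the centre `y` is defined and flat on a whole box
  -- around `(s₀, t₀)`. The factor in the `t` direction is then shrunk to a ball, which is
  -- connected.
  have hK : ∀ᶠ p in 𝓝 s₀ ×ˢ 𝓝 t₀, ∃ hz : K p ∈ L.dom y, ∀ᶠ w in 𝓝 (K p), ∀ (hw : w ∈ L.dom y)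
      (hw' : w ∈ L.dom (K p)), L.tr y (K p) hz ≪≫ L.tr (K p) w hw' = L.tr y w hw := by
    rw [← nhds_prod_eq]
    exact K.continuous.continuousAt.eventually hV
  obtain ⟨p, hp, q, hq, hpq⟩ := eventually_prod_iff.mp hK
  obtain ⟨U, hU, hUq, hUc⟩ : ∃ U ∈ 𝓝 t₀, (∀ t ∈ U, q t) ∧ _root_.IsPreconnected U := by
    obtain ⟨ε, hε, hball⟩ := Metric.mem_nhds_iff.mp hq
    refine ⟨Metric.ball t₀ ε, Metric.ball_mem_nhds _ hε, fun t ht => hball ht,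
      Set.OrdConnected.isPreconnected ⟨fun a ha b hb u hu => ?_⟩⟩
    rw [Metric.mem_ball, Subtype.dist_eq, Real.dist_eq, abs_lt] at ha hb ⊢
    have h1 : (a : ℝ) ≤ u := hu.1
    have h2 : (u : ℝ) ≤ b := hu.2
    constructor <;> linarith [ha.1, hb.2]
  have hdom : ∀ {s t}, p s → t ∈ U → K (s, t) ∈ L.dom y := fun hs ht =>
    (hpq hs (hUq _ ht)).1
  -- Read in the trivialization at `y`, the continuation is locally constant in `t` along each
  -- vertical segment of the box, hence constant on the connected set `U`.
  have key : ∀ s (hs : p s) t t' (ht : t ∈ U) (ht' : t' ∈ U),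
      F s t ≪≫ (L.tr y (K (s, t)) (hdom hs ht)).symm =
        F s t' ≪≫ (L.tr y (K (s, t')) (hdom hs ht')).symm := by
    intro s hs t t' ht ht'
    have := isPreconnected_iff_preconnectedSpace.mp hUc
    have hloc : IsLocallyConstant fun t : U =>
        F s t ≪≫ (L.tr y (K (s, t)) (hdom hs t.2)).symm := by
      rw [IsLocallyConstant.iff_eventually_eq]
      rintro ⟨r, hr⟩
      have hc : ContinuousAt (fun t' => K (s, t')) r := by fun_prop
      have h1 := hc.eventually (hpq hs (hUq r hr)).2
      have h2 := hc.eventually (L.dom_mem (K (s, r)))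
      have h3 : ∀ᶠ t' in 𝓝 r, ∀ h' : t' ∈ U, F s t' ≪≫ (L.tr y (K (s, t')) (hdom hs h')).symm =
          F s r ≪≫ (L.tr y (K (s, r)) (hdom hs hr)).symm := by
        filter_upwards [h1, h2, hFflat s r] with t' h1 h2 h3 h'
        rw [← h1 (hdom hs h') h2, ← h3 h2]
        ext
        simp
      filter_upwards [continuous_subtype_val.continuousAt.eventually h3] with t' h'
      exact h' t'.2
    exact hloc.apply_eq_of_preconnectedSpace ⟨t, ht⟩ ⟨t', ht'⟩
  refine ⟨U, hU, fun t ht t' ht' hPt => ?_⟩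
  have hs₀ : p s₀ := hp.self_of_nhds
  -- The neighbourhood of `s₀` may depend on `t`. This is harmless, as only the two heights `t` and
  -- `t'` are compared.
  have hflat : ∀ t ∈ U, ∀ᶠ s in 𝓝 s₀, ∀ (hw : K (s, t) ∈ L.dom y)
      (hw' : K (s, t) ∈ L.dom (K (s₀, t))) (hz : K (s₀, t) ∈ L.dom y),
      L.tr y (K (s₀, t)) hz ≪≫ L.tr (K (s₀, t)) (K (s, t)) hw' = L.tr y (K (s, t)) hw := by
    intro t ht
    have hc : ContinuousAt (fun s => K (s, t)) s₀ := by fun_prop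
    filter_upwards [hc.eventually (hpq hs₀ (hUq t ht)).2] with s h hw hw' hz
    exact h hw hw'
  have hc : ContinuousAt (fun s => K (s, t)) s₀ := by fun_prop
  filter_upwards [hPt, hflat t ht, hflat t' ht', hp, hc.eventually (L.dom_mem _)]
    with s h1 h2 h3 hs hd h
  have e1 := h1 hd
  have e2 := h2 (hdom hs ht) hd (hdom hs₀ ht)
  have e3 := h3 (hdom hs ht') h (hdom hs₀ ht')
  have e4 := key s hs t t' ht ht'
  have e5 := key s₀ hs₀ t t' ht ht'
  rw [← e1, ← e2] at e4
  -- Flatness in `s` says that the values at `s₀` and `s`, read in the trivialization at `y`, agree.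
  -- By `key` both values are the same at height `t'` as at height `t`, so the agreement is
  -- transferred.
  have e6 : F s₀ t ≪≫ (L.tr y (K (s₀, t)) (hdom hs₀ ht)).symm =
      F s t' ≪≫ (L.tr y (K (s, t')) (hdom hs ht')).symm := by
    rw [← e4]
    ext
    simp
  rw [e5, ← e3] at e6
  have e7 := congrArg (fun i => i ≪≫ L.tr y (K (s₀, t')) (hdom hs₀ ht') ≪≫
    L.tr (K (s₀, t')) (K (s, t')) h) e6
  simpa using e7

/-- The parallel transports along the two halves of the boundary of a square agree. -/
lemma transport_square (K : C(I × I, X)) :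
    L.transport (horizontal K 0) ≪≫ L.transport (vertical K 1) =
      L.transport (vertical K 0) ≪≫ L.transport (horizontal K 1) := by
  -- Both sides are the values at `s = 1` of families which are flat along the side `t = 1` and
  -- which start at `s = 0` with transport along `vertical K 0`.
  refine L.eq_of_flat (horizontal K 1)
    (τ := fun s => L.continuation (horizontal K 0) s ≪≫ L.continuation (vertical K s) 1)
    (τ' := fun s => L.transport (vertical K 0) ≪≫ L.continuation (horizontal K 1) s)
    (fun s => L.flat_vertical_continuation K s 1) (fun s => ?_) ?_ 1
  · filter_upwards [(L.isFlatAlong_continuation (horizontal K 1)).flat s] with s' hs' h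
    exact (Iso.trans_assoc _ _ _).trans
      (congrArg (fun i => L.transport (vertical K 0) ≪≫ i) (hs' h))
  · have e0 := (L.isFlatAlong_continuation (horizontal K 0)).zero
    have e1 := (L.isFlatAlong_continuation (horizontal K 1)).zero
    have e2 := congrArg (fun i => i ≪≫ L.continuation (vertical K 0) 1) e0
    have e3 := congrArg (fun i => L.transport (vertical K 0) ≪≫ i) e1
    exact (e2.trans (Iso.refl_trans _)).trans (e3.trans (Iso.trans_refl _)).symm

end LocalSystem

/-! ### Morphisms of stacks to `[G / Ad G]` as families of bundles. -/

/-- An isomorphism of principal bundles which respects the equivariant maps to `G` is an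
isomorphism of objects of `[G / Ad G]`. -/
def adIsoOfBundleIso {G : SchC} [GrpObj G] {T : SchC} {E E' : Bundle G T} (i : E ≅ E')
    {m : E.total ⟶ G} {m' : E'.total ⟶ G}
    (hm : ∀ {S : SchC} (x : S ⟶ E.total) (g : S ⟶ G), E.act x g ≫ m = g⁻¹ * (x ≫ m) * g)
    (hm' : ∀ {S : SchC} (x : S ⟶ E'.total) (g : S ⟶ G), E'.act x g ≫ m' = g⁻¹ * (x ≫ m') * g)
    (h : i.hom.1 ≫ m' = m) : (⟨T, E, m, hm⟩ : AdObj G) ≅ ⟨T, E', m', hm'⟩ where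
  hom := ⟨𝟙 T, i.hom.1, i.hom.2, h⟩
  inv := ⟨𝟙 T, i.inv.1, i.inv.2, by
    change i.inv.1 ≫ m = m'
    rw [← h, ← Category.assoc, IsLocalSystemMap.iso_inv_hom, Category.id_comp]⟩
  hom_inv_id := AdHom.ext (Category.comp_id _) (IsLocalSystemMap.iso_hom_inv i)
  inv_hom_id := AdHom.ext (Category.comp_id _) (IsLocalSystemMap.iso_inv_hom i)

/-- A morphism of stacks from `𝒫_{G,M}` to `[G / Ad G]` over the category of schemes, given by
principal bundles with equivariant maps to `G` which depend functorially on the framed local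
systems with pinnings. -/
structure AdFamily (A : AdjointGroup) (M : MarkedSurface) where
  bundle : ∀ P : ModuliObj A M, Bundle A.G P.base
  map : ∀ P : ModuliObj A M, (bundle P).total ⟶ A.G
  equivariant : ∀ (P : ModuliObj A M) {S : SchC} (x : S ⟶ (bundle P).total) (g : S ⟶ A.G),
    (bundle P).act x g ≫ map P = g⁻¹ * (x ≫ map P) * g
  pull : ∀ {P Q : ModuliObj A M}, ModuliHom P Q → ((bundle P).total ⟶ (bundle Q).total)
  isMap : ∀ {P Q : ModuliObj A M} (f : ModuliHom P Q),
    Bundle.IsMap f.base (bundle P) (bundle Q) (pull f)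
  comm : ∀ {P Q : ModuliObj A M} (f : ModuliHom P Q), pull f ≫ map Q = map P
  pull_id : ∀ P : ModuliObj A M, pull (𝟙 P : P ⟶ P) = 𝟙 _
  pull_comp : ∀ {P Q R : ModuliObj A M} (f : P ⟶ Q) (g : Q ⟶ R), pull (f ≫ g) = pull f ≫ pull g

namespace AdFamily

variable {A : AdjointGroup} {M : MarkedSurface}

/-- The morphism of stacks given by a family of bundles with equivariant maps to `G`. -/
def toFunctor (Φ : AdFamily A M) : moduliStack A M ⟶ adQuotient A.G where
  obj (P : ModuliObj A M) := (⟨P.base, Φ.bundle P, Φ.map P, Φ.equivariant P⟩ : AdObj A.G)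
  map {P Q : ModuliObj A M} (f : ModuliHom P Q) := ⟨f.base, Φ.pull f, Φ.isMap f, Φ.comm f⟩
  map_id P := AdHom.ext rfl (Φ.pull_id P)
  map_comp f g := AdHom.ext rfl (Φ.pull_comp f g)
  w := rfl

/-- Natural isomorphisms of the bundles which respect the equivariant maps to `G` give an
isomorphism of morphisms of stacks. -/
def iso {Φ Ψ : AdFamily A M} (i : ∀ P, Φ.bundle P ≅ Ψ.bundle P)
    (h : ∀ P, (i P).hom.1 ≫ Ψ.map P = Φ.map P)
    (nat : ∀ {P Q : ModuliObj A M} (f : ModuliHom P Q),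
      Φ.pull f ≫ (i Q).hom.1 = (i P).hom.1 ≫ Ψ.pull f) : Φ.toFunctor ≅ Ψ.toFunctor :=
  BasedNatIso.mkNatIso
    (NatIso.ofComponents (F := Φ.toFunctor.toFunctor) (G := Ψ.toFunctor.toFunctor)
      (fun P : ModuliObj A M => adIsoOfBundleIso (i P) (Φ.equivariant P) (Ψ.equivariant P) (h P))
      (fun {P Q} (f : ModuliHom P Q) => AdHom.ext
        ((Category.comp_id f.base).trans (Category.id_comp f.base).symm) (nat f)))
    -- A 2-isomorphism has to lie over the identity of the base schemes; the components have base
    -- map `𝟙` by construction.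
    (fun P : ModuliObj A M => Functor.IsHomLift.map (p := (adQuotient A.G).p)
      (adIsoOfBundleIso (i P) (Φ.equivariant P) (Ψ.equivariant P) (h P)).hom)

end AdFamily

/-! ### Wilson loops under free homotopy. -/

namespace LocalSystem

variable {X : Type} [TopologicalSpace X] {𝒞 : Type*} [Category 𝒞] (L : LocalSystem X 𝒞)

/-- The monodromies along freely homotopic loops are conjugate under parallel transport along the
track of the base point. -/
lemma monodromy_comp_transport (K : C(I × I, X)) (hK : ∀ s, K (s, 0) = K (s, 1)) :
    L.monodromy (vertical K 0) (hK 0).symm ≪≫ L.transport (horizontal K 0) =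
      L.transport (horizontal K 0) ≪≫ L.monodromy (vertical K 1) (hK 1).symm := by
  -- The sides `t = 0` and `t = 1` of the square are the same path, but only up to a propositional
  -- equality, which enters the monodromies as casts. With the two paths as variables, the equality
  -- can be substituted and the casts vanish.
  have key : ∀ (δ δ' : C(I, X)) (h : δ' = δ) (a : L.fiber (δ 0) ≅ L.fiber (δ' 0))
      (b : L.fiber (δ 1) ≅ L.fiber (δ' 1)), L.transport δ ≪≫ b = a ≪≫ L.transport δ' →
      (a ≪≫ eqToIso (congrArg (fun d : C(I, X) => L.fiber (d 0)) h)).symm ≪≫ L.transport δ =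
        L.transport δ ≪≫ (b ≪≫ eqToIso (congrArg (fun d : C(I, X) => L.fiber (d 1)) h)).symm := by
    rintro δ _ rfl a b h
    have h' := congrArg (fun i => a.symm ≪≫ i ≪≫ b.symm) h
    simpa using h'
  exact key (horizontal K 0) (horizontal K 1) (ContinuousMap.ext fun s => (hK s).symm) _ _
    (L.transport_square K)

end LocalSystem

/-- The family of bundles defining the Wilson loop. -/
def loopFamily (A : AdjointGroup) {M : MarkedSurface} (γ : C(I, M.Open)) (hγ : γ 1 = γ 0) :
    AdFamily A M where
  bundle P := P.L.fiber (γ 0)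
  map P := Bundle.autMap (P.L.monodromy γ hγ)
  equivariant _ := Bundle.autMap_equivariant _
  pull f := f.map (γ 0)
  isMap f := f.isMap.isMap (γ 0)
  comm f := AdHom.comm ((wilsonLoop A γ hγ).map f)
  pull_id _ := rfl
  pull_comp _ _ := rfl

/-- Makes `AdFamily.iso` applicable to Wilson loops; both functors are assembled from the same data.
-/
lemma loopFamily_toFunctor (A : AdjointGroup) {M : MarkedSurface} (γ : C(I, M.Open))
    (hγ : γ 1 = γ 0) : (loopFamily A γ hγ).toFunctor = wilsonLoop A γ hγ := rfl

/-- The Wilson loops along freely homotopic loops agree. -/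
theorem wilsonLoop_iso_of_homotopic (A : AdjointGroup) {M : MarkedSurface} {γ γ' : C(I, M.Open)}
    (hγ : γ 1 = γ 0) (hγ' : γ' 1 = γ' 0) (K : C(I × I, M.Open)) (h0 : ∀ t, K (0, t) = γ t)
    (h1 : ∀ t, K (1, t) = γ' t) (hK : ∀ s, K (s, 0) = K (s, 1)) :
    Nonempty (wilsonLoop A γ hγ ≅ wilsonLoop A γ' hγ') := by
  obtain rfl : vertical K 0 = γ := ContinuousMap.ext h0
  obtain rfl : vertical K 1 = γ' := ContinuousMap.ext h1
  rw [← loopFamily_toFunctor, ← loopFamily_toFunctor]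
  -- The isomorphism is transport along the track of the base point. It respects the equivariant
  -- maps because it conjugates the monodromies, and it is natural because maps of local systems
  -- commute with transport.
  exact ⟨AdFamily.iso (fun P => P.L.transport (horizontal K 0))
    (fun P => Bundle.autMap_comp (P.L.transport (horizontal K 0)).hom.2 _ _
      (congrArg (fun i => i.hom.1) (P.L.monodromy_comp_transport K hK)))
    (fun f => (f.isMap.transport (horizontal K 0)).symm)⟩

/-! ### Wilson lines under homotopy of arcs. -/

/-- The pinnings along a path in a boundary interval are obtained by parallel transport. -/
lemma ModuliObj.pin_transport {A : AdjointGroup} {M : MarkedSurface} (P : ModuliObj A M)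
    (c : C(I, M.Open)) (hc : ∀ t, c t ∈ M.bdry) :
    (P.pin (c 0) (hc 0)).map (P.L.transport c).hom = P.pin (c 1) (hc 1) := by
  have hτ := P.L.isFlatAlong_continuation c
  refine LocalSystem.unitInterval_induction
    (P := fun t => (P.pin (c 0) (hc 0)).map (P.L.continuation c t).hom = P.pin (c t) (hc t))
    ?_ (fun t => ?_) 1
  · rw [hτ.zero]
    exact Subtype.ext (Category.comp_id _)
  -- Near `t`, the continued pinning and the given pinning are both obtained from their values at
  -- `t` by the same isomorphism `tr`.
  refine ⟨{s | (P.pin (c 0) (hc 0)).map (P.L.continuation c s).hom = P.pin (c s) (hc s) ↔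
    (P.pin (c 0) (hc 0)).map (P.L.continuation c t).hom = P.pin (c t) (hc t)}, ?_,
    fun s hs s' hs' e => hs'.mpr (hs.mp e)⟩
  filter_upwards [c.continuous.continuousAt.eventually (P.L.dom_mem (c t)), hτ.flat t,
    c.continuous.continuousAt.eventually (P.pin_flat (c t) (hc t))] with s h1 h2 h3
  rw [← h2 h1, ← h3 (hc s) h1]
  have e : (P.pin (c 0) (hc 0)).map (P.L.continuation c t ≪≫ P.L.tr (c t) (c s) h1).hom =
      ((P.pin (c 0) (hc 0)).map (P.L.continuation c t).hom).map (P.L.tr (c t) (c s) h1).hom :=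
    Subtype.ext (Category.assoc _ _ _).symm
  rw [e]
  constructor
  · intro h
    have h' := congrArg (fun z => z.1 ≫ (P.L.tr (c t) (c s) h1).inv.1) h
    have hc : ∀ e : (P.L.fiber (c t)).Section,
        (e.map (P.L.tr (c t) (c s) h1).hom).1 ≫ (P.L.tr (c t) (c s) h1).inv.1 = e.1 := fun e => by
      rw [Bundle.Section.map, Category.assoc, IsLocalSystemMap.iso_hom_inv, Category.comp_id]
    exact Subtype.ext ((hc _).symm.trans (h'.trans (hc _)))
  · intro h
    rw [h]

/-- The morphism of stacks `𝒫_{G,M} → G` given by natural points of `G`. -/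
def pointFunctor {A : AdjointGroup} {M : MarkedSurface} (u : ∀ P : ModuliObj A M, P.base ⟶ A.G)
    (hu : ∀ {P Q : ModuliObj A M} (f : ModuliHom P Q), f.base ≫ u Q = u P) :
    moduliStack A M ⟶ groupStack A.G where
  obj (P : ModuliObj A M) := Over.mk (u P)
  map {P Q : ModuliObj A M} (f : ModuliHom P Q) := Over.homMk f.base (hu f)
  map_id _ := rfl
  map_comp _ _ := rfl
  w := rfl

/-- The value of the Wilson line. -/
def linePoint {A : AdjointGroup} {M : MarkedSurface} (c : C(I, M.Open)) (h0 : c 0 ∈ M.bdry)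
    (h1 : c 1 ∈ M.bdry) (P : ModuliObj A M) : P.base ⟶ A.G :=
  (((P.pin (c 0) h0).map (P.L.transport c).hom).div (P.pin (c 1) h1)) * A.w0At P.base

/-- Naturality is already contained in the action of `wilsonLine` on morphisms, as the commuting
triangle over `G`. -/
lemma comp_linePoint {A : AdjointGroup} {M : MarkedSurface} (c : C(I, M.Open)) (h0 : c 0 ∈ M.bdry)
    (h1 : c 1 ∈ M.bdry) {P Q : ModuliObj A M} (f : ModuliHom P Q) :
    f.base ≫ linePoint c h0 h1 Q = linePoint c h0 h1 P :=
  Over.w ((wilsonLine A c h0 h1).map (show (P : (moduliStack A M).obj) ⟶ Q from f))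

/-- Exhibits the Wilson line as a function of its values alone, so that an equality of points of `G`
yields an equality of functors. -/
lemma wilsonLine_eq_pointFunctor (A : AdjointGroup) {M : MarkedSurface} (c : C(I, M.Open))
    (h0 : c 0 ∈ M.bdry) (h1 : c 1 ∈ M.bdry) :
    wilsonLine A c h0 h1 = pointFunctor (linePoint c h0 h1) (comp_linePoint c h0 h1) := rfl

/-- The Wilson lines along homotopic arcs agree. -/
theorem wilsonLine_eq_of_homotopic (A : AdjointGroup) {M : MarkedSurface} {c c' : C(I, M.Open)}
    (h0 : c 0 ∈ M.bdry) (h1 : c 1 ∈ M.bdry) (h0' : c' 0 ∈ M.bdry) (h1' : c' 1 ∈ M.bdry)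
    (K : C(I × I, M.Open)) (hc : ∀ t, K (0, t) = c t) (hc' : ∀ t, K (1, t) = c' t)
    (hK0 : ∀ s, K (s, 0) ∈ M.bdry) (hK1 : ∀ s, K (s, 1) ∈ M.bdry) :
    wilsonLine A c h0 h1 = wilsonLine A c' h0' h1' := by
  obtain rfl : vertical K 0 = c := ContinuousMap.ext hc
  obtain rfl : vertical K 1 = c' := ContinuousMap.ext hc'
  have key : ∀ P : ModuliObj A M,
      ((P.pin (K (0, 0)) h0).map (P.L.transport (vertical K 0)).hom).div (P.pin (K (0, 1)) h1) =
      ((P.pin (K (1, 0)) h0').map (P.L.transport (vertical K 1)).hom).div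
        (P.pin (K (1, 1)) h1') := by
    intro P
    -- Transport along the track of the final end point carries both sections of the first quotient
    -- to those of the second: the continued initial pinning by `transport_square` and flatness of
    -- the pinnings along the initial track, the final pinning by flatness along the final track. An
    -- isomorphism of bundles preserves quotients of sections.
    have e := (Bundle.Section.div_comp (P.L.transport (horizontal K 1)).hom.2
      ((P.pin (K (0, 0)) h0).map (P.L.transport (vertical K 0)).hom) (P.pin (K (0, 1)) h1)
      ((P.pin (K (1, 0)) h0').map (P.L.transport (vertical K 1)).hom) (P.pin (K (1, 1)) h1') ?_ ?_)
    · rwa [Category.id_comp] at e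
    · rw [Category.id_comp]
      have e1 := congrArg Subtype.val (P.pin_transport (horizontal K 0) hK0)
      have e2 := congrArg (fun i => (P.pin (K (0, 0)) h0).1 ≫ i.hom.1)
        (P.L.transport_square K)
      have e3 := congrArg (fun i => i ≫ (P.L.transport (vertical K 1)).hom.1) e1
      exact (Category.assoc _ _ _).trans (e2.symm.trans ((Category.assoc _ _ _).symm.trans e3))
    · rw [Category.id_comp]
      exact congrArg Subtype.val (P.pin_transport (horizontal K 1) hK1)
  have hu : linePoint (A := A) (vertical K 0) h0 h1 = linePoint (vertical K 1) h0' h1' :=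
    funext fun P => congrArg (fun u => u * A.w0At P.base) (key P)
  rw [wilsonLine_eq_pointFunctor, wilsonLine_eq_pointFunctor]
  congr 1

/-! ### The Wilson line followed by the projection to `[G / Ad G]`. -/

namespace Bundle

variable {G : SchC} [GrpObj G] {T T' : SchC}

/-- The unit section of the trivial bundle. -/
def unitSection (G : SchC) [GrpObj G] (T : SchC) : (trivial G T).Section :=
  ⟨lift (𝟙 T) 1, lift_fst _ _⟩

lemma unitSection_comp (b : T ⟶ T') :
    (unitSection G T).1 ≫ b ▷ G = b ≫ (unitSection G T').1 := by
  change lift (𝟙 T) 1 ≫ b ▷ G = b ≫ lift (𝟙 T') 1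
  ext <;> simp [MonObj.comp_one]

/-- A map of bundles respects equivariant maps to `G` if it does so on a section. -/
lemma comp_equivariant {E E' : Bundle G T} (f : E ⟶ E') {m : E.total ⟶ G} {m' : E'.total ⟶ G}
    (hm : ∀ {S : SchC} (x : S ⟶ E.total) (g : S ⟶ G), E.act x g ≫ m = g⁻¹ * (x ≫ m) * g)
    (hm' : ∀ {S : SchC} (x : S ⟶ E'.total) (g : S ⟶ G), E'.act x g ≫ m' = g⁻¹ * (x ≫ m') * g)
    (e : E.Section) (h : (e.1 ≫ f.1) ≫ m' = e.1 ≫ m) : f.1 ≫ m' = m := by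
  have hp : (E.proj ≫ e.1) ≫ E.proj = 𝟙 E.total ≫ E.proj := by
    rw [Category.assoc, e.2, Category.comp_id, Category.id_comp]
  -- The tautological point of the total space is a translate of the section `e`, so equivariance
  -- reduces both sides to conjugates, by the same element, of their values on `e`.
  rw [← Category.id_comp (f.1 ≫ m'), ← Category.id_comp m, ← E.act_div _ _ hp, hm,
    ← Category.assoc, f.2.act, hm', Category.assoc E.proj e.1 m, ← h]
  simp only [Category.assoc]

end Bundle

/-- The family of trivial bundles defining the composite of the Wilson line with the projection to
`[G / Ad G]`. -/
def lineFamily (A : AdjointGroup) {M : MarkedSurface} (c : C(I, M.Open)) (h0 : c 0 ∈ M.bdry)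
    (h1 : c 1 ∈ M.bdry) : AdFamily A M where
  bundle P := Bundle.trivial A.G P.base
  map P := (snd P.base A.G)⁻¹ * (fst P.base A.G ≫ linePoint c h0 h1 P) * snd P.base A.G
  equivariant P := ((adProjection A.G).obj (Over.mk (linePoint c h0 h1 P))).equivariant
  pull f := f.base ▷ A.G
  isMap f := AdHom.isMap ((wilsonLine A c h0 h1 ≫ adProjection A.G).map f)
  comm f := AdHom.comm ((wilsonLine A c h0 h1 ≫ adProjection A.G).map f)
  pull_id _ := MonoidalCategory.id_whiskerRight _ _
  pull_comp _ _ := MonoidalCategory.comp_whiskerRight _ _ _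

lemma lineFamily_toFunctor (A : AdjointGroup) {M : MarkedSurface} (c : C(I, M.Open))
    (h0 : c 0 ∈ M.bdry) (h1 : c 1 ∈ M.bdry) :
    (lineFamily A c h0 h1).toFunctor = wilsonLine A c h0 h1 ≫ adProjection A.G := rfl

/-- On the unit section the conjugation `h⁻¹ u h` is trivial. This single value determines the
equivariant map. -/
lemma unitSection_lineFamily {A : AdjointGroup} {M : MarkedSurface} (c : C(I, M.Open))
    (h0 : c 0 ∈ M.bdry) (h1 : c 1 ∈ M.bdry) (P : ModuliObj A M) :
    (Bundle.unitSection A.G P.base).1 ≫ (lineFamily A c h0 h1).map P = linePoint c h0 h1 P := by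
  change lift (𝟙 P.base) 1 ≫ ((snd P.base A.G)⁻¹ * (fst P.base A.G ≫ linePoint c h0 h1 P) *
    snd P.base A.G) = _
  simp [MonObj.comp_mul, GrpObj.comp_inv]

/-- The definition `u = h w₀` with the quotient `h` eliminated: since `e₂ = τ(e₁) h`, the translate
`e₁ u` is transported to `e₂ w₀`. The right-hand side is the frame of the opposite pinning, which is
what the gluing identifies with `e₁`. -/
lemma act_linePoint {A : AdjointGroup} {M : MarkedSurface} (c : C(I, M.Open)) (h0 : c 0 ∈ M.bdry)
    (h1 : c 1 ∈ M.bdry) (P : ModuliObj A M) :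
    (P.L.fiber (c 0)).act (P.pin (c 0) h0).1 (linePoint c h0 h1 P) ≫ (P.L.transport c).hom.1 =
      ((P.pin (c 1) h1).act (A.w0At P.base)).1 := by
  rw [(P.L.transport c).hom.2.act, linePoint, (P.L.fiber (c 1)).act_mul]
  exact congrArg (fun x => (P.L.fiber (c 1)).act x (A.w0At P.base))
    (Bundle.Section.act_div ((P.pin (c 0) h0).map (P.L.transport c).hom) (P.pin (c 1) h1))

/-! ### The monodromy of the glued local system. -/

namespace Gluing

variable {M M' : MarkedSurface} (g : Gluing M M')

/-- The family of bundles defining the composite of the gluing morphism with a Wilson loop. -/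
def glueFamily (A : AdjointGroup) (γ : C(I, M'.Open)) (hγ : γ 1 = γ 0) : AdFamily A M where
  bundle P := (g.glueL P).fiber (γ 0)
  map P := Bundle.autMap ((g.glueL P).monodromy γ hγ)
  equivariant _ := Bundle.autMap_equivariant _
  pull f := f.map (g.rep (γ 0))
  isMap f := f.isMap.isMap (g.rep (γ 0))
  comm f := AdHom.comm (((g.gluingMorphism A).q ≫ wilsonLoop A γ hγ).map f)
  pull_id _ := rfl
  pull_comp _ _ := rfl

/-- Holds by definition because `gluingMorphism` is the explicit construction, whose objects have
local system `glueL` over the unchanged base. -/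
lemma glueFamily_toFunctor (A : AdjointGroup) (γ : C(I, M'.Open)) (hγ : γ 1 = γ 0) :
    (g.glueFamily A γ hγ).toFunctor = (g.gluingMorphism A).q ≫ wilsonLoop A γ hγ := rfl

variable {A : AdjointGroup} (P : ModuliObj A M)

lemma hat_of_mem_left {x : M.Open} (hx : x ∈ g.E₁.points) (h : x ∈ g.edges) :
    g.hat P x h = P.pin x (g.E₁.mem_bdry hx) := by
  obtain ⟨t, rfl⟩ := hx
  exact g.hat_left P t h

lemma hat_of_mem_right {x : M.Open} (hx : x ∈ g.E₂.points) (h : x ∈ g.edges) :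
    g.hat P x h = (P.pin x (g.E₂.mem_bdry hx)).act (A.w0At P.base) := by
  obtain ⟨t, rfl⟩ := hx
  exact g.hat_right P t h

/-- The gluing condition inside the glued fibre: the distinguished frames at two identified points
become one section, up to the cast between equal fibres. It follows from `hat_ident` and the
transitivity of the identifications. -/
lemma hat_toRep {x y : M.Open} (h : g.map y = g.map x) (hx : x ∈ g.edges) (hy : y ∈ g.edges) :
    ((g.hat P y hy).1 ≫ (g.toRep P y).hom.1) ≫
      (eqToIso (congrArg (g.glueL P).fiber h)).hom.1 =
      (g.hat P x hx).1 ≫ (g.toRep P x).hom.1 := by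
  -- With the image point as a variable, the cast is absorbed into the identification of the fibre
  -- at `y` with the representing fibre.
  have e : ∀ (z : M'.Open) (hz : g.map y = z),
      ((g.hat P y hy).1 ≫ (g.toRep P y).hom.1) ≫
        (eqToIso (congrArg (g.glueL P).fiber hz)).hom.1 =
      (g.hat P y hy).1 ≫ (g.ident P y (g.rep z) (hz.trans (g.map_rep z).symm)).hom.1 := by
    rintro _ rfl
    exact Category.comp_id _
  refine (e _ h).trans ?_
  rw [← g.hat_ident P x y h.symm hx hy]
  have e1 := congrArg (fun i => (g.hat P x hx).1 ≫ i.hom.1)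
    (g.ident_trans P x y _ h.symm (h.trans (g.map_rep' x)))
  exact (Category.assoc _ _ _).trans e1

variable (c : C(I, M.Open)) (h0 : c 0 ∈ g.E₁.points) (h1 : c 1 ∈ g.E₂.points)

/-- The section of the glued local system at the beginning of an arc given by the pinning. -/
def baseSection : ((g.glueL P).fiber (g.map (c 0))).Section :=
  (P.pin (c 0) (g.E₁.mem_bdry h0)).map (g.toRep P (c 0)).hom

/-- The heart of the argument: in the frame given by the pinning at the beginning of the arc, the
matrix of the monodromy is the value of the Wilson line, with no inverse or further factor. -/
lemma baseSection_monodromy (h : g.map (c 1) = g.map (c 0)) :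
    (g.baseSection P c h0).1 ≫ ((g.glueL P).monodromy (g.map.comp c) h).hom.1 =
      ((g.glueL P).fiber (g.map (c 0))).act (g.baseSection P c h0).1
        (linePoint c (g.E₁.mem_bdry h0) (g.E₂.mem_bdry h1) P) := by
  set u := linePoint c (g.E₁.mem_bdry h0) (g.E₂.mem_bdry h1) P with hu
  -- Transport along the image path is transport along `c` read through `toRep`, so `act_linePoint`
  -- descends to the glued local system.
  have e0 : ((g.glueL P).fiber (g.map (c 0))).act (g.baseSection P c h0).1 u ≫
      ((g.glueL P).transport (g.map.comp c)).hom.1 =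
      (g.hat P (c 1) (Or.inr h1)).1 ≫ (g.toRep P (c 1)).hom.1 := by
    have e1 : ((g.glueL P).fiber (g.map (c 0))).act (g.baseSection P c h0).1 u =
        (P.L.fiber (c 0)).act (P.pin (c 0) (g.E₁.mem_bdry h0)).1 u ≫ (g.toRep P (c 0)).hom.1 :=
      ((g.toRep P (c 0)).hom.2.act _ _).symm
    have e2 := (g.isLocalSystemMap_toRep P).transport c
    rw [LocalSystem.transport_pullback] at e2
    have e3 := congrArg (fun e => e.1) (g.hat_of_mem_right P h1 (Or.inr h1))
    have e4 := e3.trans (act_linePoint c (g.E₁.mem_bdry h0) (g.E₂.mem_bdry h1) P).symm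
    have e5 := congrArg (fun x => x ≫ (g.toRep P (c 1)).hom.1) e4
    refine (congrArg (fun x => x ≫ ((g.glueL P).transport (g.map.comp c)).hom.1) e1).trans
      (Eq.trans ?_ e5.symm)
    exact (Category.assoc _ _ _).trans ((congrArg _ e2.symm).trans (Category.assoc _ _ _).symm)
  -- The inverse of the monodromy is forward transport followed by the cast closing the loop. By the
  -- gluing condition this cast takes the image of `e₂ w₀` to the image of `e₁`.
  have e3 : ((g.glueL P).fiber (g.map (c 0))).act (g.baseSection P c h0).1 u ≫
      ((g.glueL P).monodromy (g.map.comp c) h).inv.1 = (g.baseSection P c h0).1 := by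
    have e4 := g.hat_toRep P h (Or.inl h0) (Or.inr h1)
    have e5 := congrArg (fun e => e.1 ≫ (g.toRep P (c 0)).hom.1)
      (g.hat_of_mem_left P h0 (Or.inl h0))
    have e6 := congrArg (fun x => x ≫ (eqToIso (congrArg (g.glueL P).fiber h)).hom.1) e0
    exact (Category.assoc _ _ _).symm.trans (e6.trans (e4.trans e5))
  have e5 := congrArg (fun x => x ≫ ((g.glueL P).monodromy (g.map.comp c) h).hom.1) e3
  refine e5.symm.trans ((Category.assoc _ _ _).trans ?_)
  rw [IsLocalSystemMap.iso_inv_hom]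
  exact Category.comp_id _

/-- The Wilson line along an arc whose end points are identified by the gluing gives the Wilson loop
along the image of the arc. -/
theorem wilsonLine_iso_wilsonLoop (A : AdjointGroup) (h : g.map (c 1) = g.map (c 0)) :
    Nonempty (wilsonLine A c (g.E₁.mem_bdry h0) (g.E₂.mem_bdry h1) ≫ adProjection A.G ≅
      (g.gluingMorphism A).q ≫ wilsonLoop A (g.map.comp c) h) := by
  rw [← lineFamily_toFunctor, ← glueFamily_toFunctor]
  -- The pinning supplies a global frame of the fibre, hence a trivialization valid over the whole
  -- base.
  let i : ∀ P : ModuliObj A M, Bundle.trivial A.G P.base ≅ (g.glueL P).fiber (g.map (c 0)) :=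
    fun P => Bundle.frameIso (Bundle.unitSection A.G P.base) (g.baseSection P c h0)
  have hi : ∀ P : ModuliObj A M, (Bundle.unitSection A.G P.base).1 ≫ (i P).hom.1 =
      (g.baseSection P c h0).1 := fun P => Bundle.comp_frameHom _ _
  refine ⟨AdFamily.iso i (fun P => ?_) (fun {P Q} f => ?_)⟩
  · refine Bundle.comp_equivariant (i P).hom ((lineFamily A c _ _).equivariant P)
      (Bundle.autMap_equivariant ((g.glueL P).monodromy (g.map.comp c) h))
      (Bundle.unitSection A.G P.base) ?_
    rw [hi]
    refine Eq.trans ?_ (unitSection_lineFamily c _ _ P).symm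
    -- The value of the monodromy map on the base section is determined by its action on that
    -- section.
    apply ((g.glueL P).fiber (g.map (c 0))).act_cancel (x := (g.baseSection P c h0).1)
    exact (Bundle.act_autMap _ _).trans (g.baseSection_monodromy P c h0 h1 h)
  -- Both composites in the naturality square are bundle maps over `f.base`, so they need only be
  -- compared on the unit section. There the claim is that base sections are pulled back to base
  -- sections, which holds because `f` respects pinnings.
  · have m1 := ((lineFamily A c (g.E₁.mem_bdry h0) (g.E₂.mem_bdry h1)).isMap f).comp (i Q).hom.2
    have m2 := (i P).hom.2.comp ((g.glueFamily A (g.map.comp c) h).isMap f)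
    rw [Category.comp_id] at m1
    rw [Category.id_comp] at m2
    refine Bundle.isMap_ext m1 m2 (Bundle.unitSection A.G P.base) ?_
    have e1 : (g.baseSection P c h0).1 ≫ f.map (g.rep (g.map (c 0))) =
        f.base ≫ (g.baseSection Q c h0).1 := by
      have e2 := g.ident_natural f (c 0) _ (g.map_rep' (c 0))
      have e3 := f.pin (c 0) (g.E₁.mem_bdry h0)
      change ((P.pin (c 0) _).1 ≫ (g.toRep P (c 0)).hom.1) ≫ _ =
        f.base ≫ (Q.pin (c 0) _).1 ≫ (g.toRep Q (c 0)).hom.1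
      rw [Category.assoc, e2, ← Category.assoc, e3, Category.assoc]
    refine (Category.assoc _ _ _).symm.trans (Eq.trans ?_ (Category.assoc _ _ _))
    refine Eq.trans ?_ ((congrArg (fun x => x ≫ f.map (g.rep (g.map (c 0)))) (hi P)).trans e1).symm
    refine (congrArg (fun x => x ≫ (i Q).hom.1) (Bundle.unitSection_comp f.base)).trans ?_
    exact (Category.assoc _ _ _).trans (congrArg (fun x => f.base ≫ x) (hi Q))

end Gluing

end WilsonLines

end

/-! ### Arbitrary representatives of the arc class and of the free loop. -/

theorem proposition3p6 (A : WilsonLines.AdjointGroup) (M M' : WilsonLines.MarkedSurface)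
    (g : WilsonLines.Gluing M M')
    (c : C(unitInterval, M.Open)) (h0 : c 0 ∈ g.E₁.points) (h1 : c 1 ∈ g.E₂.points)
    (γ : C(unitInterval, M'.Open)) (hγ : γ 1 = γ 0) (h : g.LoopFromArc c γ) :
    Nonempty
      (WilsonLines.wilsonLine A c (g.E₁.mem_bdry h0) (g.E₂.mem_bdry h1) ≫
          WilsonLines.adProjection A.G ≅
        (g.gluingMorphism A).q ≫ WilsonLines.wilsonLoop A γ hγ) := by
  obtain ⟨c', ⟨K, hK0, hK1, hK⟩, hc', K', hK'0, hK'1, hK'⟩ := h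
  have h0' : c' 0 ∈ g.E₁.points := hK1 0 ▸ (hK 1).1
  have h1' : c' 1 ∈ g.E₂.points := hK1 1 ▸ (hK 1).2
  -- Equality of Wilson lines allows `c` to be replaced by the arc `c'` with identified end points.
  -- The loop `γ` is exchanged for the image of `c'` only up to the isomorphism `j`.
  rw [WilsonLines.wilsonLine_eq_of_homotopic A _ _ (g.E₁.mem_bdry h0') (g.E₂.mem_bdry h1') K hK0 hK1
    (fun s => g.E₁.mem_bdry (hK s).1) (fun s => g.E₂.mem_bdry (hK s).2)]
  obtain ⟨i⟩ := g.wilsonLine_iso_wilsonLoop c' h0' h1' A hc'.symm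
  obtain ⟨j⟩ := WilsonLines.wilsonLoop_iso_of_homotopic A hγ
    (γ' := g.map.comp c') hc'.symm K' hK'0 hK'1 hK'
  exact ⟨i ≪≫ (Bicategory.whiskerLeftIso (g.gluingMorphism A).q j).symm⟩
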